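/- Let $(E,(\cdot,\cdot),\mathcal H)$ be an extended affine Lie algebra over $\mathbb K=\mathbb C$: $E$ is a complex Lie algebra, $(\cdot,\cdot)$ is a non-degenerate invariant symmetric bilinear form on $E$, $\mathcal H\neq 0$ is a finite dimensional subalgebra, $E=\sum_{\alpha\in\mathcal H^\star}E_\alpha$ with $E_\alpha=\{x\in E\mid [h,x]=\alpha(h)x \text{ for all } h\in\mathcal H\}$, $E_0=\mathcal H$, and, with the root system $R=\{\alpha\in\mathcal H^\star\mid E_\alpha\ne 0\}$, the transferred form on $\mathcal H^\star$, $R^0=\{\alpha\in R\mid(\alpha,\alpha)=0\}$, $R^\times=R\setminus R^0$, and the core $E_c$ (the subalgebra generated by the $E_\alpha$, $\alpha\in R^\times$): $\mathrm{ad}(x)$ is locally nilpotent for $x\in E_\alpha$, $\alpha\in R^\times$; the centralizer of $E_c$ in $E$ is contained in $E_c$; the root lattice $\langle R\rangle=\mathbb Z\text{-span}(R)$ is free abelian of finite rank; and $R^\times$ is not the disjoint union of two non-empty mutually orthogonal subsets. Assume that $E$ is of reduced type, i.e. the image of $R$ in $\mathrm{span}_{\mathbb R}R/\mathrm{span}_{\mathbb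 R}R^0$ is a reduced root system. For $P\subseteq R^\times$ let $\mathcal W_P$ be the group generated by the reflections $w_\alpha(\beta)=\beta-\frac{2(\beta,\alpha)}{(\alpha,\alpha)}\alpha$, $\alpha\in P$. A reflectable base is a subset $P\subseteq R^\times$ with $\mathcal W_PP=R^\times$ that is minimal with this property. Let $\mathrm{refl}(R)$ be the smallest cardinality of a reflectable base, $\mathrm{ind}(R)=\mathrm{refl}(R)-\mathrm{rank}\langle R\rangle$, and let $\mathrm{null}(R)$ be the rank of the free abelian group $\langle R^0\rangle$. (1) If $\mathrm{ind}(R)=0$, then for every finite-order Cartan automorphism $\Psi$ of $E$ (a finite-order Lie algebra automorphism with $\Psi(h)=h$ for all $h\in\mathcal H$) there is a finite-order root-lattice character, i.e. a group homomorphism $\chi:\langle R\rangle\to\mathbb K^\times$ of finite order, such that $\Psi(x)=\chi(\alpha)x$ for all $\alpha\in R$ and $x\in E_\alpha$. (2) If $R$ is finite or affine, i.e. $\mathrm{null}(R)\in\{0,1\}$, then every character of $R$, i.e. every map $\psi:R\to\mathbb K^\times$ with $\psi(\alpha+\beta)=\psi(\alpha)\psi(\beta)$ whenever $\alpha,\beta,\alpha+\beta\in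 R$, is the restriction to $R$ of a group homomorphism $\langle R\rangle\to\mathbb K^\times$. -/

import Mathlib

noncomputable section

/-- For a subalgebra `H` of a Lie algebra `E` and `α ∈ H⋆`, the space
`E_α = {x ∈ E | [h, x] = α(h) x for all h ∈ H}`. -/
def weightSpaceOf {E : Type*} [LieRing E] [LieAlgebra ℂ E] (H : LieSubalgebra ℂ E)
    (α : Module.Dual ℂ H) : Submodule ℂ E where
  carrier := {x | ∀ h : H, ⁅(h : E), x⁆ = α h • x}
  add_mem' := by
    intro x y hx hy h
    rw [lie_add, hx h, hy h, smul_add]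
  zero_mem' := by
    intro h
    simp
  smul_mem' := by
    intro c x hx h
    rw [lie_smul, hx h, smul_comm]

/-- A Lie algebra `E` over `ℂ` with an invariant non-degenerate symmetric
bilinear form and a non-trivial finite dimensional splitting Cartan subalgebra. -/
structure SplitLieTriple (E : Type*) [LieRing E] [LieAlgebra ℂ E] where
  form : LinearMap.BilinForm ℂ E
  cartan : LieSubalgebra ℂ E
  form_symm : form.IsSymm
  form_invariant : ∀ x y z : E, form ⁅x, y⁆ z = form x ⁅y, z⁆
  form_nondegenerate : form.Nondegenerate
  cartan_ne_bot : cartan ≠ ⊥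
  cartan_finiteDimensional : FiniteDimensional ℂ cartan
  iSup_weightSpace : ⨆ α : Module.Dual ℂ cartan, weightSpaceOf cartan α = ⊤
  weightSpace_zero : weightSpaceOf cartan 0 = cartan.toSubmodule

namespace SplitLieTriple

variable {E : Type*} [LieRing E] [LieAlgebra ℂ E] (T : SplitLieTriple E)

/-- The dual space `H⋆` of the Cartan subalgebra. -/
abbrev CartanDual : Type _ := Module.Dual ℂ T.cartan

/-- The root space `E_α`. -/
abbrev rootSpace (α : T.CartanDual) : Submodule ℂ E := weightSpaceOf T.cartan α

/-- The root system `R` of `E`; note `0 ∈ R`. -/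
def roots : Set T.CartanDual := {α | T.rootSpace α ≠ ⊥}

/-- The form restricted to the Cartan subalgebra. -/
def cartanForm : LinearMap.BilinForm ℂ T.cartan :=
  LinearMap.BilinForm.restrict T.form T.cartan.toSubmodule

theorem cartanForm_nondegenerate : T.cartanForm.Nondegenerate := by
  have hsymm : T.cartanForm.IsSymm := ⟨fun x y => T.form_symm.eq (x : E) (y : E)⟩
  have hleft : ∀ h : T.cartan, (∀ k : T.cartan, T.form h k = 0) → h = 0 := by
    intro h hh
    have key : ∀ x : E, T.form h x = 0 := by
      intro x
      have hx : x ∈ ⨆ α : Module.Dual ℂ T.cartan, weightSpaceOf T.cartan α := by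
        rw [T.iSup_weightSpace]; trivial
      induction hx using Submodule.iSup_induction' with
      | mem α x hx =>
        by_cases hα : α = 0
        · subst hα
          rw [T.weightSpace_zero] at hx
          exact hh ⟨x, hx⟩
        · obtain ⟨k, hk⟩ : ∃ k, α k ≠ 0 := by
            by_contra! hcon
            exact hα (LinearMap.ext hcon)
          have h1 : ⁅(k : E), x⁆ = α k • x := hx k
          have h0 : (k : E) ∈ weightSpaceOf T.cartan 0 := by
            rw [T.weightSpace_zero]; exact k.2
          have h2 : ⁅(h : E), (k : E)⁆ = 0 := by
            have := h0 h
            simpa using this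
          have h3 := T.form_invariant (h : E) (k : E) x
          rw [h2, h1] at h3
          simp only [map_zero, LinearMap.zero_apply, map_smul, smul_eq_mul] at h3
          rcases mul_eq_zero.mp h3.symm with h4 | h4
          · exact absurd h4 hk
          · exact h4
      | zero => simp
      | add x y _ _ hx hy => rw [map_add, hx, hy, add_zero]
    exact Subtype.ext (T.form_nondegenerate.1 (h : E) key)
  refine ⟨fun h hh => hleft h hh, fun h hh => hleft h fun k => ?_⟩
  have h5 := hh k
  rw [← h5]
  exact T.form_symm.eq (h : E) (k : E)

/-- The element `t_α ∈ H` with `(t_α, h) = α(h)` for all `h ∈ H`. -/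
def t (α : T.CartanDual) : T.cartan :=
  haveI := T.cartan_finiteDimensional
  (T.cartanForm.toDual T.cartanForm_nondegenerate).symm α

theorem form_t (α : T.CartanDual) (h : T.cartan) : T.form (T.t α) h = α h := by
  have := T.cartan_finiteDimensional
  exact LinearMap.BilinForm.apply_toDual_symm_apply (hB := T.cartanForm_nondegenerate) α h

/-- The form `(α, β) = (t_α, t_β)` on `H⋆`. -/
def dualForm (α β : T.CartanDual) : ℂ := T.form (T.t α) (T.t β)

/-- The isotropic roots `R⁰`. -/
def isotropicRoots : Set T.CartanDual := {α ∈ T.roots | T.dualForm α α = 0}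

/-- The non-isotropic roots `Rˣ`. -/
def nonisotropicRoots : Set T.CartanDual := {α ∈ T.roots | T.dualForm α α ≠ 0}

/-- The core `E_c`: the subalgebra generated by the non-isotropic root spaces. -/
def core : LieSubalgebra ℂ E :=
  LieSubalgebra.lieSpan ℂ E (⋃ α ∈ T.nonisotropicRoots, (T.rootSpace α : Set E))

/-- The root lattice `⟨R⟩`. -/
def rootLattice : AddSubgroup T.CartanDual := AddSubgroup.closure T.roots

end SplitLieTriple

/-- An extended affine Lie algebra (tameness is included among the axioms). -/
structure ExtendedAffineLieAlgebra (E : Type*) [LieRing E] [LieAlgebra ℂ E]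
    extends SplitLieTriple E where
  /-- `ad x` is locally nilpotent for `x ∈ E_α`, `α ∈ Rˣ`. -/
  ad_locally_nilpotent : ∀ α ∈ toSplitLieTriple.nonisotropicRoots,
    ∀ x ∈ toSplitLieTriple.rootSpace α, ∀ y : E, ∃ n : ℕ, ((LieAlgebra.ad ℂ E x) ^ n) y = 0
  /-- The centralizer of the core is contained in the core. -/
  tame : ∀ x : E, (∀ y ∈ toSplitLieTriple.core, ⁅x, y⁆ = 0) → x ∈ toSplitLieTriple.core
  /-- The root lattice `⟨R⟩` is a free abelian group of finite rank. -/
  rootLattice_free : Module.Free ℤ toSplitLieTriple.rootLattice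
  rootLattice_finite : Module.Finite ℤ toSplitLieTriple.rootLattice
  /-- `Rˣ` is not a disjoint union of two non-empty orthogonal subsets. -/
  indecomposable : ∀ R₁ R₂ : Set toSplitLieTriple.CartanDual,
    R₁ ∪ R₂ = toSplitLieTriple.nonisotropicRoots → Disjoint R₁ R₂ → R₁.Nonempty → R₂.Nonempty →
    ∃ α ∈ R₁, ∃ β ∈ R₂, toSplitLieTriple.dualForm α β ≠ 0

namespace ExtendedAffineLieAlgebra

variable {E : Type*} [LieRing E] [LieAlgebra ℂ E] (T : ExtendedAffineLieAlgebra E)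

/-- `E` is of reduced type: the image of the root system in `V / V⁰` (where `V`, `V⁰` are the real
spans of `R`, `R⁰`) is a reduced root system, that is, no non-zero element of the image has its
double in the image. -/
def IsReducedType : Prop :=
  ∀ α ∈ T.nonisotropicRoots, ∀ β ∈ T.nonisotropicRoots,
    β - (2 : ℝ) • α ∉ Submodule.span ℝ T.isotropicRoots

/-- The group `W_P` generated by the reflections `β ↦ β - (2(β, α) / (α, α)) α`, `α ∈ P`, for a set
`P` of non-isotropic roots, acting on `H⋆ ⊇ R`. -/
def weylSubgroup (P : Set T.CartanDual) : Subgroup (T.CartanDual ≃ₗ[ℂ] T.CartanDual) :=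
  Subgroup.closure {w | ∃ α ∈ P, ∀ β : T.CartanDual,
    w β = β - (2 * T.dualForm β α / T.dualForm α α) • α}

/-- `P ⊆ Rˣ` satisfies `W_P P = Rˣ`. -/
def IsReflectableSet (P : Set T.CartanDual) : Prop :=
  P ⊆ T.nonisotropicRoots ∧
    {β | ∃ w ∈ T.weylSubgroup P, ∃ α ∈ P, β = w α} = T.nonisotropicRoots

/-- A reflectable base: `P ⊆ Rˣ` with `W_P P = Rˣ`, no proper subset of which has this property. -/
def IsReflectableBase (P : Set T.CartanDual) : Prop :=
  T.IsReflectableSet P ∧ ∀ Q : Set T.CartanDual, Q ⊂ P → ¬ T.IsReflectableSet Q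

/-- `refl(R)`: the smallest cardinality of a reflectable base. -/
def refl : ℕ :=
  sInf {n : ℕ | ∃ P : Set T.CartanDual, T.IsReflectableBase P ∧ P.encard = n}

/-- `ind(R) = refl(R) - rank ⟨R⟩`. -/
def ind : ℤ := (T.refl : ℤ) - (Module.finrank ℤ T.rootLattice : ℤ)

/-- The nullity of `R`: the rank of the free abelian group `⟨R⁰⟩`. -/
def nullity : ℕ := Module.finrank ℤ (AddSubgroup.closure T.isotropicRoots)

/-- A Cartan automorphism: an automorphism of the Lie algebra `E` that fixes `H` pointwise. -/
def IsCartanAutomorphism (Ψ : E ≃ₗ⁅ℂ⁆ E) : Prop := ∀ h ∈ T.cartan, Ψ h = h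

/-- A character of `R`: a map `ψ : R → ℂˣ` with `ψ(α + β) = ψ(α) ψ(β)` for `α, β, α + β ∈ R`. -/
def IsCharacter (ψ : T.roots → ℂˣ) : Prop :=
  ∀ α β γ : T.roots, (γ : T.CartanDual) = α + β → ψ γ = ψ α * ψ β

/-- A root-lattice character: a group homomorphism `⟨R⟩ → ℂˣ`. -/
abbrev RootLatticeCharacter : Type _ := Multiplicative T.rootLattice →* ℂˣ

/-- The restriction of a root-lattice character to `R`. -/
def RootLatticeCharacter.onRoot {T : ExtendedAffineLieAlgebra E} (χ : T.RootLatticeCharacter)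
    (α : T.roots) : ℂˣ :=
  χ (Multiplicative.ofAdd ⟨α, AddSubgroup.subset_closure α.2⟩)

end ExtendedAffineLieAlgebra

/-- A Lie algebra automorphism of finite order. -/
def IsFiniteOrderAut {E : Type*} [LieRing E] [LieAlgebra ℂ E] (Ψ : E ≃ₗ⁅ℂ⁆ E) : Prop :=
  ∃ n : ℕ, 0 < n ∧ ∀ x : E, Ψ^[n] x = x

end

/-! For (1), a Cartan automorphism preserves root spaces. Non-isotropic root spaces are lines, so it
acts on each by a scalar, and `sl₂`-strings give the scalar on `E_{w_α β}` from those on `E_α` and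
`E_β` by the rule a lattice character obeys. A reflectable base generates the lattice (isotropic
roots are differences of non-isotropic ones, by tameness); when `ind(R) = 0` its size is the rank,
so it is a basis. The scalars on it define `χ`, and reflections spread the agreement to all of
`R^×`. On `E_δ` with `δ` isotropic, the defect `Ψ x - χ(δ) x` centralizes the core, hence lies in
it, and there `Ψ` acts by `χ(δ)`: a Jordan block, which finite order and characteristic zero forbid.

For (2), it suffices to find a lattice basis of roots from which every root is reached by adding
positive roots. An injective homomorphism `f` from the lattice to the reals makes each non-zero root
positive or negative. Nullity at most one makes the positive roots below any bound finite in number,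
so simple roots (the indecomposable positive ones) generate the lattice and allow induction on `f`.
They are real, pairwise obtuse and connected for the semidefinite form `∑ c(x) c(y)` over the
finitely many coroots `c`, and hence independent. A character prescribed on simple roots then agrees
with `ψ` on all roots. -/

noncomputable section

/-! ### Root spaces, the invariant form and the `sl₂` computation -/

namespace SplitLieTriple

variable {E : Type*} [LieRing E] [LieAlgebra ℂ E] (T : SplitLieTriple E)
variable {α β : T.CartanDual} {x y : E}

theorem lie_mem_rootSpace (hx : x ∈ T.rootSpace α) (hy : y ∈ T.rootSpace β) :
    ⁅x, y⁆ ∈ T.rootSpace (α + β) := by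
  intro h
  rw [leibniz_lie, hx h, hy h, smul_lie, lie_smul, LinearMap.add_apply, add_smul]

theorem ad_pow_mem_rootSpace (hx : x ∈ T.rootSpace α) (hy : y ∈ T.rootSpace β) (n : ℕ) :
    ((LieAlgebra.ad ℂ E x) ^ n) y ∈ T.rootSpace (β + (n : ℤ) • α) := by
  induction n with
  | zero => simpa using hy
  | succ n ih =>
    rw [pow_succ', Module.End.mul_apply, LieAlgebra.ad_apply]
    have h : β + ((n + 1 : ℕ) : ℤ) • α = α + (β + (n : ℤ) • α) := by
      rw [Nat.cast_succ, add_zsmul, one_zsmul]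
      abel
    rw [h]
    exact T.lie_mem_rootSpace hx ih

theorem mem_roots_of_ne_zero (hx : x ∈ T.rootSpace α) (h : x ≠ 0) : α ∈ T.roots :=
  fun hbot => h ((Submodule.mem_bot ℂ).1 (hbot ▸ hx))

theorem exists_ne_zero_of_mem_roots (h : α ∈ T.roots) : ∃ x ∈ T.rootSpace α, x ≠ 0 :=
  (Submodule.ne_bot_iff _).1 h

theorem eq_zero_of_notMem_roots (h : α ∉ T.roots) (hx : x ∈ T.rootSpace α) : x = 0 :=
  by_contra fun h0 => h (T.mem_roots_of_ne_zero hx h0)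

theorem form_eq_zero_of_add_ne_zero (hx : x ∈ T.rootSpace α) (hy : y ∈ T.rootSpace β)
    (h : α + β ≠ 0) : T.form x y = 0 := by
  obtain ⟨k, hk⟩ : ∃ k, (α + β) k ≠ 0 := by
    by_contra! hcon
    exact h (LinearMap.ext hcon)
  have h3 := T.form_invariant x (k : E) y
  rw [← lie_skew, hx k, hy k] at h3
  simp only [map_neg, LinearMap.neg_apply, map_smul, LinearMap.smul_apply, smul_eq_mul] at h3
  rw [LinearMap.add_apply] at hk
  have h4 : (α k + β k) * T.form x y = 0 := by linear_combination -h3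
  exact (mul_eq_zero.1 h4).resolve_left hk

/-- By weights `E_α` is orthogonal to every `E_β` with `β ≠ -α`, so non-degeneracy descends to the
pairing of `E_α` with `E_{-α}`. -/
theorem eq_zero_of_form_eq_zero (hx : x ∈ T.rootSpace α)
    (h : ∀ y ∈ T.rootSpace (-α), T.form x y = 0) : x = 0 := by
  refine T.form_nondegenerate.1 x fun y => ?_
  have hy : y ∈ ⨆ β : Module.Dual ℂ T.cartan, weightSpaceOf T.cartan β := by
    rw [T.iSup_weightSpace]; trivial
  induction hy using Submodule.iSup_induction' with
  | mem β y hy =>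
    by_cases hβ : α + β = 0
    · obtain rfl : β = -α := (neg_eq_of_add_eq_zero_right hβ).symm
      exact h y hy
    · exact T.form_eq_zero_of_add_ne_zero hx hy hβ
  | zero => simp
  | add y z _ _ hy hz => rw [map_add, hy, hz, add_zero]

theorem neg_mem_roots (h : α ∈ T.roots) : -α ∈ T.roots := by
  intro hbot
  obtain ⟨x, hx, hx0⟩ := T.exists_ne_zero_of_mem_roots h
  refine hx0 (T.eq_zero_of_form_eq_zero hx fun y hy => ?_)
  rw [hbot, Submodule.mem_bot] at hy
  simp [hy]

theorem exists_form_eq (hx : x ∈ T.rootSpace α) (hx0 : x ≠ 0) (c : ℂ) :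
    ∃ y ∈ T.rootSpace (-α), T.form x y = c := by
  obtain ⟨y, hy, hxy⟩ : ∃ y ∈ T.rootSpace (-α), T.form x y ≠ 0 := by
    by_contra! hcon
    exact hx0 (T.eq_zero_of_form_eq_zero hx hcon)
  refine ⟨(c / T.form x y) • y, Submodule.smul_mem _ _ hy, ?_⟩
  rw [map_smul, smul_eq_mul, div_mul_cancel₀ _ hxy]

theorem mem_cartan_iff : x ∈ T.cartan ↔ x ∈ T.rootSpace 0 := by
  rw [rootSpace, T.weightSpace_zero, LieSubalgebra.mem_toSubmodule]

theorem zero_mem_roots : (0 : T.CartanDual) ∈ T.roots := by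
  intro h
  apply T.cartan_ne_bot
  rw [rootSpace, T.weightSpace_zero] at h
  exact (LieSubalgebra.toSubmodule_eq_bot T.cartan).1 h

theorem dualForm_eq (α β : T.CartanDual) : T.dualForm α β = α (T.t β) := T.form_t α _

theorem dualForm_comm (α β : T.CartanDual) : T.dualForm α β = T.dualForm β α :=
  T.form_symm.eq _ _

/-- The form on `H⋆` as a homomorphism in its first argument. -/
def dualFormHom (β : T.CartanDual) : T.CartanDual →ₗ[ℂ] ℂ where
  toFun α := T.dualForm α β
  map_add' := by simp [dualForm_eq]
  map_smul' := by simp [dualForm_eq]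

@[simp] theorem dualFormHom_apply (α β : T.CartanDual) : T.dualFormHom β α = T.dualForm α β := rfl

theorem dualForm_add_left (α β γ : T.CartanDual) :
    T.dualForm (α + β) γ = T.dualForm α γ + T.dualForm β γ := map_add (T.dualFormHom γ) α β

theorem dualForm_zero_left (γ : T.CartanDual) : T.dualForm 0 γ = 0 := map_zero (T.dualFormHom γ)

theorem dualForm_neg_left (α γ : T.CartanDual) : T.dualForm (-α) γ = -T.dualForm α γ :=
  map_neg (T.dualFormHom γ) α

theorem dualForm_zsmul_left (n : ℤ) (α γ : T.CartanDual) :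
    T.dualForm (n • α) γ = n * T.dualForm α γ := by
  rw [← zsmul_eq_mul]
  exact map_zsmul (T.dualFormHom γ) n α

theorem dualForm_add_right (α β γ : T.CartanDual) :
    T.dualForm γ (α + β) = T.dualForm γ α + T.dualForm γ β := by
  rw [dualForm_comm, dualForm_add_left, dualForm_comm, T.dualForm_comm β]

theorem dualForm_neg_right (α γ : T.CartanDual) : T.dualForm γ (-α) = -T.dualForm γ α := by
  rw [dualForm_comm, dualForm_neg_left, dualForm_comm]

theorem dualForm_zsmul_right (n : ℤ) (α γ : T.CartanDual) :
    T.dualForm γ (n • α) = n * T.dualForm γ α := by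
  rw [dualForm_comm, dualForm_zsmul_left, dualForm_comm]

theorem lie_t (hx : x ∈ T.rootSpace β) (α : T.CartanDual) :
    ⁅(T.t α : E), x⁆ = T.dualForm β α • x := by
  rw [dualForm_eq]
  exact hx (T.t α)

/-- Both sides lie in `E_0 = H`, and by invariance they pair equally with all of `H`. -/
theorem lie_eq_form_smul_t (hx : x ∈ T.rootSpace α) (hy : y ∈ T.rootSpace (-α)) :
    ⁅x, y⁆ = T.form x y • (T.t α : E) := by
  have h0 : ⁅x, y⁆ ∈ T.rootSpace 0 := by simpa using T.lie_mem_rootSpace hx hy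
  have ht : (T.t α : E) ∈ T.rootSpace 0 := T.mem_cartan_iff.1 (T.t α).2
  rw [← sub_eq_zero]
  refine T.eq_zero_of_form_eq_zero (Submodule.sub_mem _ h0 (Submodule.smul_mem _ _ ht)) ?_
  intro h hh
  rw [neg_zero, ← T.mem_cartan_iff] at hh
  lift h to T.cartan using hh
  have h1 := T.form_symm.eq (h : E) ⁅x, y⁆
  have h2 := T.form_invariant (h : E) x y
  rw [hx h, map_smul, LinearMap.smul_apply] at h2
  rw [map_sub, LinearMap.sub_apply, map_smul, LinearMap.smul_apply, T.form_t, ← h1, ← h2]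
  simp [mul_comm]

/-- `(x, y)` is left free and `(α, α)` may vanish, so that the formula covers both `sl₂` and, for
isotropic `α`, the Heisenberg algebra. -/
theorem lie_ad_pow_succ (hx : x ∈ T.rootSpace α) (hy : y ∈ T.rootSpace (-α)) {v : E}
    (hv : v ∈ T.rootSpace β) (hxv : ⁅x, v⁆ = 0) (j : ℕ) :
    ⁅x, ((LieAlgebra.ad ℂ E y) ^ (j + 1)) v⁆ =
      (T.form x y * ((j + 1) * T.dualForm β α - j * (j + 1) / 2 * T.dualForm α α)) •
        ((LieAlgebra.ad ℂ E y) ^ j) v := by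
  have key : ∀ j : ℕ, ⁅⁅x, y⁆, ((LieAlgebra.ad ℂ E y) ^ j) v⁆ =
      (T.form x y * (T.dualForm β α - j * T.dualForm α α)) • ((LieAlgebra.ad ℂ E y) ^ j) v := by
    intro j
    rw [T.lie_eq_form_smul_t hx hy, smul_lie, T.lie_t (T.ad_pow_mem_rootSpace hy hv j), smul_smul,
      dualForm_add_left, dualForm_zsmul_left, dualForm_neg_left]
    congr 2
    push_cast
    ring
  induction j with
  | zero =>
    have := key 0
    rw [zero_add, pow_one, LieAlgebra.ad_apply, leibniz_lie, hxv, lie_zero, add_zero]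
    simpa using this
  | succ j ih =>
    rw [pow_succ', Module.End.mul_apply, LieAlgebra.ad_apply, leibniz_lie, key, ih, lie_smul,
      ← LieAlgebra.ad_apply ℂ, ← Module.End.mul_apply, ← pow_succ', ← add_smul]
    congr 1
    push_cast
    ring

theorem exists_ad_pow_eq_zero {n : ℕ} {v : E} (h : ((LieAlgebra.ad ℂ E x) ^ n) v = 0) (hv : v ≠ 0) :
    ∃ m : ℕ, ((LieAlgebra.ad ℂ E x) ^ m) v ≠ 0 ∧ ⁅x, ((LieAlgebra.ad ℂ E x) ^ m) v⁆ = 0 := by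
  classical
  have hex : ∃ n, ((LieAlgebra.ad ℂ E x) ^ n) v = 0 := ⟨n, h⟩
  have hpos : Nat.find hex ≠ 0 := fun h0 => hv (by simpa [h0] using Nat.find_spec hex)
  obtain ⟨m, hm⟩ := Nat.exists_eq_succ_of_ne_zero hpos
  refine ⟨m, Nat.find_min hex (by omega), ?_⟩
  have := Nat.find_spec hex
  rwa [hm, Nat.succ_eq_add_one, pow_succ', Module.End.mul_apply, LieAlgebra.ad_apply] at this

end SplitLieTriple

/-! ### Root strings, isotropic roots and tameness -/

namespace ExtendedAffineLieAlgebra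

variable {E : Type*} [LieRing E] [LieAlgebra ℂ E] (T : ExtendedAffineLieAlgebra E)
variable {α β δ : T.CartanDual} {x y : E}

theorem neg_mem_nonisotropicRoots (h : α ∈ T.nonisotropicRoots) : -α ∈ T.nonisotropicRoots := by
  refine ⟨T.neg_mem_roots h.1, ?_⟩
  rw [T.dualForm_neg_left, T.dualForm_neg_right, neg_neg]
  exact h.2

theorem exists_sl2_partner (hα : α ∈ T.nonisotropicRoots) :
    ∃ e ∈ T.rootSpace α, ∃ f ∈ T.rootSpace (-α), T.form e f = 2 / T.dualForm α α := by
  obtain ⟨e, he, he0⟩ := T.exists_ne_zero_of_mem_roots hα.1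
  obtain ⟨f, hf, hef⟩ := T.exists_form_eq he he0 (2 / T.dualForm α α)
  exact ⟨e, he, f, hf, hef⟩

/-- The integrality and non-vanishing statement of `sl₂`-theory for locally nilpotent actions. -/
theorem exists_ladder (hα : α ∈ T.nonisotropicRoots) (hx : x ∈ T.rootSpace α)
    (hy : y ∈ T.rootSpace (-α)) (hxy : T.form x y = 2 / T.dualForm α α) {v : E}
    (hv : v ∈ T.rootSpace β) (hv0 : v ≠ 0) :
    ∃ n N : ℕ, 2 * T.dualForm β α / T.dualForm α α + 2 * n = N ∧ (⁅x, v⁆ = 0 → n = 0) ∧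
      ∀ j ≤ N, ((LieAlgebra.ad ℂ E y) ^ j) (((LieAlgebra.ad ℂ E x) ^ n) v) ≠ 0 := by
  obtain ⟨n₀, hn₀⟩ := T.ad_locally_nilpotent α hα x hx v
  obtain ⟨n, hn, hxn⟩ : ∃ n : ℕ, (((LieAlgebra.ad ℂ E x) ^ n) v ≠ 0 ∧
      ⁅x, ((LieAlgebra.ad ℂ E x) ^ n) v⁆ = 0) := SplitLieTriple.exists_ad_pow_eq_zero hn₀ hv0
  have hn' : ⁅x, v⁆ = 0 → n = 0 := by
    intro h
    by_contra hne
    obtain ⟨m, rfl⟩ := Nat.exists_eq_succ_of_ne_zero hne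
    apply hn
    rw [Nat.succ_eq_add_one, pow_succ, Module.End.mul_apply, LieAlgebra.ad_apply, h, map_zero]
  set u := ((LieAlgebra.ad ℂ E x) ^ n) v with hu
  have hu' : u ∈ T.rootSpace (β + (n : ℤ) • α) := T.ad_pow_mem_rootSpace hx hv n
  obtain ⟨m₀, hm₀⟩ := T.ad_locally_nilpotent (-α) (T.neg_mem_nonisotropicRoots hα) y hy u
  obtain ⟨m, hm, hym⟩ := SplitLieTriple.exists_ad_pow_eq_zero hm₀ hn
  refine ⟨n, m, ?_, hn', fun j hj h0 => hm ?_⟩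
  -- Lowering `y^m u` once more gives zero, so the commutation formula forces the weight of `u` to
  -- be `m`.
  · have h1 := T.lie_ad_pow_succ hx hy hu' hxn m
    rw [pow_succ', Module.End.mul_apply, LieAlgebra.ad_apply, hym, lie_zero] at h1
    have h2 := (smul_eq_zero.1 h1.symm).resolve_right hm
    have h3 : (m + 1 : ℂ) ≠ 0 := by exact_mod_cast Nat.succ_ne_zero m
    have h4 := hα.2
    rw [hxy, T.dualForm_add_left, T.dualForm_zsmul_left] at h2
    have h5 : (m + 1 : ℂ) * (2 * T.dualForm β α / T.dualForm α α + 2 * n - m) = 0 := by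
      rw [← h2]
      field_simp
      push_cast
      ring
    exact sub_eq_zero.1 ((mul_eq_zero.1 h5).resolve_left h3)
  · obtain ⟨k, rfl⟩ := Nat.exists_eq_add_of_le' hj
    rw [pow_add, Module.End.mul_apply, h0, map_zero]

theorem exists_int_eq (hα : α ∈ T.nonisotropicRoots) (hβ : β ∈ T.roots) :
    ∃ k : ℤ, 2 * T.dualForm β α / T.dualForm α α = k := by
  obtain ⟨e, he, f, hf, hef⟩ := T.exists_sl2_partner hα
  obtain ⟨v, hv, hv0⟩ := T.exists_ne_zero_of_mem_roots hβ
  obtain ⟨n, N, h, -⟩ := T.exists_ladder hα he hf hef hv hv0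
  exact ⟨N - 2 * n, by push_cast; linear_combination h⟩

/-- Raise `n` times to the top of the string, then lower `n + j` times; since `n + j ≤ k + 2n = N`,
the result is non-zero. -/
theorem sub_zsmul_mem_roots (hα : α ∈ T.nonisotropicRoots) (hβ : β ∈ T.roots) {k j : ℤ}
    (hk : 2 * T.dualForm β α / T.dualForm α α = k) (h0 : 0 ≤ j) (hj : j ≤ k) :
    β - j • α ∈ T.roots := by
  obtain ⟨e, he, f, hf, hef⟩ := T.exists_sl2_partner hα
  obtain ⟨v, hv, hv0⟩ := T.exists_ne_zero_of_mem_roots hβ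
  obtain ⟨n, N, h, -, h2⟩ := T.exists_ladder hα he hf hef hv hv0
  rw [hk] at h
  have h' : k + 2 * n = N := by exact_mod_cast h
  have h3 := h2 (n + j).toNat (by omega)
  have h4 := T.ad_pow_mem_rootSpace hf (T.ad_pow_mem_rootSpace he hv n) (n + j).toNat
  have h5 := T.mem_roots_of_ne_zero h4 h3
  rw [Int.toNat_of_nonneg (by omega), smul_neg, add_smul] at h5
  convert h5 using 1
  abel

theorem two_mul_dualForm_neg_div (α β : T.CartanDual) :
    2 * T.dualForm β (-α) / T.dualForm (-α) (-α) = -(2 * T.dualForm β α / T.dualForm α α) := by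
  rw [T.dualForm_neg_right, T.dualForm_neg_left, T.dualForm_neg_right, neg_neg]
  ring

theorem reflect_mem_roots (hα : α ∈ T.nonisotropicRoots) (hβ : β ∈ T.roots) {k : ℤ}
    (hk : 2 * T.dualForm β α / T.dualForm α α = k) : β - k • α ∈ T.roots := by
  rcases le_total 0 k with h | h
  · exact T.sub_zsmul_mem_roots hα hβ hk h le_rfl
  · have := T.sub_zsmul_mem_roots (T.neg_mem_nonisotropicRoots hα) hβ (k := -k) (j := -k)
      (by rw [T.two_mul_dualForm_neg_div, hk]; push_cast; rfl) (by omega) le_rfl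
    simpa using this

theorem dualForm_reflect (hα : T.dualForm α α ≠ 0) {k : ℤ}
    (hk : 2 * T.dualForm β α / T.dualForm α α = k) :
    T.dualForm (β - k • α) (β - k • α) = T.dualForm β β := by
  rw [div_eq_iff hα] at hk
  rw [sub_eq_add_neg, ← neg_smul, T.dualForm_add_left, T.dualForm_add_right, T.dualForm_add_right,
    T.dualForm_zsmul_left, T.dualForm_zsmul_left, T.dualForm_zsmul_right, T.dualForm_zsmul_right,
    T.dualForm_comm α β]
  push_cast
  linear_combination (-(k : ℂ)) * hk

theorem reflect_mem_nonisotropicRoots (hα : α ∈ T.nonisotropicRoots)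
    (hβ : β ∈ T.nonisotropicRoots) {k : ℤ} (hk : 2 * T.dualForm β α / T.dualForm α α = k) :
    β - k • α ∈ T.nonisotropicRoots :=
  ⟨T.reflect_mem_roots hα hβ.1 hk, by rw [T.dualForm_reflect hα.2 hk]; exact hβ.2⟩

/-- Non-isotropic root spaces are at most one-dimensional. -/
theorem exists_eq_smul (hα : α ∈ T.nonisotropicRoots) (hx : x ∈ T.rootSpace α) (hx0 : x ≠ 0)
    (hy : y ∈ T.rootSpace α) : ∃ c : ℂ, y = c • x := by
  have hα2 := hα.2
  obtain ⟨f, hf, hxf⟩ := T.exists_form_eq hx hx0 (2 / T.dualForm α α)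
  have hs : (2 / T.dualForm α α : ℂ) ≠ 0 := div_ne_zero two_ne_zero hα2
  refine ⟨T.form y f / (2 / T.dualForm α α), sub_eq_zero.1 ?_⟩
  set c := T.form y f / (2 / T.dualForm α α) with hc
  have hz : y - c • x ∈ T.rootSpace α := Submodule.sub_mem _ hy (Submodule.smul_mem _ _ hx)
  have hzf : T.form (y - c • x) f = 0 := by
    rw [map_sub, LinearMap.sub_apply, map_smul, LinearMap.smul_apply, hxf, smul_eq_mul, hc,
      div_mul_cancel₀ _ hs, sub_self]
  have hfz : ⁅f, y - c • x⁆ = 0 := by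
    rw [← lie_skew, T.lie_eq_form_smul_t hz hf, hzf, zero_smul, neg_zero]
  by_contra hz0
  have hfx : T.form f x = 2 / T.dualForm (-α) (-α) := by
    rw [T.dualForm_neg_left, T.dualForm_neg_right, neg_neg, ← hxf]
    exact T.form_symm.eq _ _
  -- The vector `y - c • x` is killed by `f`, so it tops its string for `-α` (`n = 0`), yet its
  -- weight there is `-2 < 0`.
  obtain ⟨n, N, h, hn, -⟩ := T.exists_ladder (T.neg_mem_nonisotropicRoots hα) hf
    (by rwa [neg_neg]) hfx hz hz0
  rw [hn hfz, T.two_mul_dualForm_neg_div, mul_div_assoc, div_self hα2] at h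
  have h' : (((-2 : ℤ) : ℂ)) = ((N : ℤ) : ℂ) := by
    push_cast
    linear_combination h
  have := Int.cast_injective h'
  omega

/-- Isotropic roots are orthogonal to non-isotropic roots. -/
theorem dualForm_eq_zero_of_isotropic (hα : α ∈ T.nonisotropicRoots) (hδ : δ ∈ T.isotropicRoots) :
    T.dualForm α δ = 0 := by
  by_contra hc
  -- `(α + nδ, α + nδ) = 2(α, δ)(a + n)`, so `δ` has Cartan integer `1 / (a + n)` against a
  -- non-isotropic `α + nδ`; integrality then bounds `n`.
  set a := T.dualForm α α / (2 * T.dualForm α δ) with ha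
  have bound : ∀ n : ℤ, α + n • δ ∈ T.roots → ‖a + n‖ ≤ 1 := by
    intro n hn
    have hγ : T.dualForm (α + n • δ) (α + n • δ) = 2 * T.dualForm α δ * (a + n) := by
      rw [T.dualForm_add_left, T.dualForm_add_right, T.dualForm_add_right, T.dualForm_zsmul_left,
        T.dualForm_zsmul_left, T.dualForm_zsmul_right, T.dualForm_zsmul_right, hδ.2,
        T.dualForm_comm δ α, ha]
      field_simp
      ring
    by_cases h0 : a + n = 0
    · simp [h0]
    have hiso : α + n • δ ∈ T.nonisotropicRoots :=
      ⟨hn, by rw [hγ]; exact mul_ne_zero (mul_ne_zero two_ne_zero hc) h0⟩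
    obtain ⟨k, hk⟩ := T.exists_int_eq hiso hδ.1
    rw [hγ, T.dualForm_add_right, T.dualForm_zsmul_right, hδ.2, mul_zero, add_zero,
      T.dualForm_comm δ α, div_mul_eq_div_div, div_self (mul_ne_zero two_ne_zero hc)] at hk
    have hk0 : k ≠ 0 := by
      rintro rfl
      simp [h0] at hk
    have hk1 : (1 : ℝ) ≤ ‖(k : ℂ)‖ := by
      rw [Complex.norm_intCast]
      exact_mod_cast Int.one_le_abs hk0
    rw [← hk, norm_div, norm_one, le_div_iff₀ (norm_pos_iff.2 h0), one_mul] at hk1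
    exact hk1
  have bound' : ∀ n : ℤ, α + n • δ ∈ T.roots → |(n : ℝ)| ≤ 1 + ‖a‖ := by
    intro n hn
    have h1 := bound n hn
    have h2 : ‖(n : ℂ)‖ ≤ ‖a + n‖ + ‖a‖ := by
      simpa using norm_sub_le (a + n) a
    rw [Complex.norm_intCast] at h2
    linarith
  obtain ⟨M, hM⟩ := exists_nat_gt (1 + ‖a‖)
  obtain ⟨v, hv, hv0⟩ := T.exists_ne_zero_of_mem_roots hα.1
  obtain ⟨x, hx, hx0⟩ := T.exists_ne_zero_of_mem_roots hδ.1
  obtain ⟨y, hy, hxy⟩ := T.exists_form_eq hx hx0 1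
  have hxM : ((LieAlgebra.ad ℂ E x) ^ M) v = 0 := by
    by_contra h0
    have := bound' M (T.mem_roots_of_ne_zero (T.ad_pow_mem_rootSpace hx hv M) h0)
    rw [Int.cast_natCast, Nat.abs_cast] at this
    linarith
  obtain ⟨m, hm, hxm⟩ := SplitLieTriple.exists_ad_pow_eq_zero hxM hv0
  have hu := T.ad_pow_mem_rootSpace hx hv m
  -- `x`, `y` and `t_δ` span a Heisenberg algebra whose centre `t_δ` acts by `(α, δ) ≠ 0`, so
  -- lowering a vector killed by `x` never stops.
  have hne : ∀ j : ℕ, ((LieAlgebra.ad ℂ E y) ^ j) (((LieAlgebra.ad ℂ E x) ^ m) v) ≠ 0 := by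
    intro j
    induction j with
    | zero => simpa using hm
    | succ j ih =>
      intro h0
      have h1 := T.lie_ad_pow_succ hx hy hu hxm j
      rw [h0, lie_zero, hxy, hδ.2, T.dualForm_add_left, T.dualForm_zsmul_left, hδ.2, mul_zero,
        mul_zero, add_zero, sub_zero, one_mul] at h1
      have h2 := (smul_eq_zero.1 h1.symm).resolve_right ih
      rcases mul_eq_zero.1 h2 with h3 | h3
      · exact Nat.cast_add_one_ne_zero j h3
      · exact hc h3
  -- From `α + mδ`, lowering `m + M` times reaches `α - Mδ`, beyond the bound.
  have hroot := T.mem_roots_of_ne_zero (T.ad_pow_mem_rootSpace hy hu (m + M)) (hne (m + M))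
  have hroot' : α + (-(M : ℤ)) • δ ∈ T.roots := by
    convert hroot using 1
    push_cast
    module
  have := bound' _ hroot'
  rw [Int.cast_neg, abs_neg, Int.cast_natCast, Nat.abs_cast] at this
  linarith

theorem add_isotropic_mem (hα : α ∈ T.nonisotropicRoots) (hδ : δ ∈ T.isotropicRoots)
    (h : α + δ ∈ T.roots) : α + δ ∈ T.nonisotropicRoots := by
  refine ⟨h, ?_⟩
  rw [T.dualForm_add_left, T.dualForm_add_right, T.dualForm_add_right, hδ.2, T.dualForm_comm δ α,
    T.dualForm_eq_zero_of_isotropic hα hδ, add_zero, add_zero, add_zero]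
  exact hα.2

theorem lie_core_eq_zero (h : ∀ α ∈ T.nonisotropicRoots, ∀ y ∈ T.rootSpace α, ⁅x, y⁆ = 0)
    (hy : y ∈ T.core) : ⁅x, y⁆ = 0 := by
  refine LieSubalgebra.lieSpan_induction (p := fun y _ => ⁅x, y⁆ = 0) ℂ ?_ ?_ ?_ ?_ ?_ hy
  · intro y hy
    obtain ⟨α, hα, hyα⟩ := Set.mem_iUnion₂.1 hy
    exact h α hα y hyα
  · simp
  · intro y z _ _ h1 h2
    rw [lie_add, h1, h2, add_zero]
  · intro a y _ h1
    rw [lie_smul, h1, smul_zero]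
  · intro y z _ _ h1 h2
    rw [leibniz_lie, h1, h2, zero_lie, lie_zero, add_zero]

/-- Isotropic roots are non-isolated. -/
theorem exists_add_mem_nonisotropicRoots (hδ : δ ∈ T.isotropicRoots) :
    ∃ α ∈ T.nonisotropicRoots, α + δ ∈ T.nonisotropicRoots := by
  by_contra! hcon
  have hcon' : ∀ α ∈ T.nonisotropicRoots, α + δ ∉ T.roots :=
    fun α hα h => hcon α hα (T.add_isotropic_mem hα hδ h)
  obtain ⟨x, hx, hx0⟩ := T.exists_ne_zero_of_mem_roots hδ.1
  -- If no `α + δ` is a root, `E_δ` commutes with the generators of the core; tameness puts it in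
  -- the core.
  have hxc : x ∈ T.core := by
    refine T.tame x fun y hy => T.lie_core_eq_zero (fun α hα z hz => ?_) hy
    refine T.eq_zero_of_notMem_roots (hcon' α hα) ?_
    rw [add_comm]
    exact T.lie_mem_rootSpace hx hz
  refine hx0 (T.eq_zero_of_form_eq_zero hx fun y hy => ?_)
  have hyc : ∀ z ∈ T.core, ⁅y, z⁆ = 0 := by
    refine fun z hz => T.lie_core_eq_zero (fun α hα z hz => ?_) hz
    refine T.eq_zero_of_notMem_roots (fun h => ?_) (T.lie_mem_rootSpace hy hz)
    have h1 := T.neg_mem_roots h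
    rw [neg_add, neg_neg, add_comm] at h1
    exact hcon' (-α) (T.neg_mem_nonisotropicRoots hα) h1
  -- `y` is orthogonal to the core: to generators because `δ ∉ R^×`, to brackets because `([u, v],
  -- y) = (u, [v, y]) = 0`.
  refine LieSubalgebra.lieSpan_induction (p := fun x _ => T.form x y = 0) ℂ ?_ ?_ ?_ ?_ ?_ hxc
  · intro z hz
    obtain ⟨α, hα, hzα⟩ := Set.mem_iUnion₂.1 hz
    refine T.form_eq_zero_of_add_ne_zero hzα hy fun h => hα.2 ?_
    rw [← sub_eq_add_neg, sub_eq_zero] at h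
    rw [h, hδ.2]
  · simp
  · intro u v _ _ h1 h2
    rw [map_add, LinearMap.add_apply, h1, h2, add_zero]
  · intro a u _ h1
    rw [map_smul, LinearMap.smul_apply, h1, smul_zero]
  · intro u v _ hv _ _
    rw [T.form_invariant, ← lie_skew, hyc v hv, neg_zero, map_zero]

theorem mem_roots_cases (h : α ∈ T.roots) : α ∈ T.nonisotropicRoots ∨ α ∈ T.isotropicRoots := by
  by_cases h0 : T.dualForm α α = 0
  · exact Or.inr ⟨h, h0⟩
  · exact Or.inl ⟨h, h0⟩

theorem rootLattice_le {A : AddSubgroup T.CartanDual} (h : T.nonisotropicRoots ⊆ A) :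
    T.rootLattice ≤ A := by
  refine (AddSubgroup.closure_le _).2 fun δ hδ => ?_
  rcases T.mem_roots_cases hδ with h1 | h1
  · exact h h1
  · obtain ⟨α, hα, hαδ⟩ := T.exists_add_mem_nonisotropicRoots h1
    have := A.sub_mem (h hαδ) (h hα)
    rwa [add_sub_cancel_left] at this

theorem nonisotropicRoots_nonempty : T.nonisotropicRoots.Nonempty := by
  by_contra hne
  rw [Set.not_nonempty_iff_eq_empty] at hne
  have hcore : T.core = ⊥ := by simp [SplitLieTriple.core, hne]
  apply T.cartan_ne_bot
  rw [eq_bot_iff]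
  intro x _
  have := T.tame x (by simp [hcore])
  rwa [hcore] at this

/-- `Ψ` acts on the root space `E_α` as multiplication by `a`. -/
def ActsBy (Ψ : E ≃ₗ⁅ℂ⁆ E) (α : T.CartanDual) (a : ℂˣ) : Prop :=
  ∀ x ∈ T.rootSpace α, Ψ x = (a : ℂ) • x

/-! ### Eigenvalues of a Cartan automorphism -/

variable {T} {Ψ : E ≃ₗ⁅ℂ⁆ E}

theorem IsCartanAutomorphism.mem_rootSpace (hΨ : T.IsCartanAutomorphism Ψ)
    (hx : x ∈ T.rootSpace α) : Ψ x ∈ T.rootSpace α := by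
  intro h
  rw [← hΨ h h.2, ← LieEquiv.map_lie, hx h, map_smul]

theorem IsCartanAutomorphism.exists_actsBy (hΨ : T.IsCartanAutomorphism Ψ)
    (hα : α ∈ T.nonisotropicRoots) : ∃ a : ℂˣ, T.ActsBy Ψ α a := by
  obtain ⟨x, hx, hx0⟩ := T.exists_ne_zero_of_mem_roots hα.1
  obtain ⟨a, ha⟩ := T.exists_eq_smul hα hx hx0 (hΨ.mem_rootSpace hx)
  have ha0 : a ≠ 0 := by
    rintro rfl
    rw [zero_smul] at ha
    refine hx0 (Ψ.injective ?_)
    change Ψ x = Ψ 0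
    rw [ha, map_zero]
  refine ⟨Units.mk0 a ha0, fun y hy => ?_⟩
  obtain ⟨c, rfl⟩ := T.exists_eq_smul hα hx hx0 hy
  rw [map_smul, ha, Units.val_mk0, smul_comm]

theorem ActsBy.of_ne_zero {a : ℂˣ} (hα : α ∈ T.nonisotropicRoots) (hx : x ∈ T.rootSpace α)
    (hx0 : x ≠ 0) (h : Ψ x = (a : ℂ) • x) : T.ActsBy Ψ α a := by
  intro y hy
  obtain ⟨c, rfl⟩ := T.exists_eq_smul hα hx hx0 hy
  rw [map_smul, h, smul_comm]

/-- `Ψ` fixes `[e, f]`, a non-zero multiple of `t_α`, so the two eigenvalues are inverse. -/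
theorem ActsBy.neg (hΨ : T.IsCartanAutomorphism Ψ) (hα : α ∈ T.nonisotropicRoots) {a : ℂˣ}
    (h : T.ActsBy Ψ α a) : T.ActsBy Ψ (-α) a⁻¹ := by
  obtain ⟨b, hb⟩ := hΨ.exists_actsBy (T.neg_mem_nonisotropicRoots hα)
  obtain ⟨e, he, f, hf, hef⟩ := T.exists_sl2_partner hα
  have h1 : ⁅e, f⁆ = T.form e f • (T.t α : E) := T.lie_eq_form_smul_t he hf
  have h2 : ⁅e, f⁆ ≠ 0 := by
    rw [h1, hef]
    refine smul_ne_zero (div_ne_zero two_ne_zero hα.2) fun h0 => hα.2 ?_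
    rw [SplitLieTriple.dualForm, h0, map_zero]
  have h3 : Ψ ⁅e, f⁆ = ⁅e, f⁆ := by
    rw [h1, map_smul, hΨ _ (T.t α).2]
  rw [LieEquiv.map_lie, h e he, hb f hf, smul_lie, lie_smul, smul_smul] at h3
  have h4 : ((a : ℂ) * b - 1) • ⁅e, f⁆ = 0 := by rw [sub_smul, h3, one_smul, sub_self]
  have h5 : a * b = 1 :=
    Units.ext (by simpa using sub_eq_zero.1 ((smul_eq_zero.1 h4).resolve_right h2))
  rwa [inv_eq_of_mul_eq_one_right h5]

theorem ActsBy.ad_pow {a b : ℂˣ} {v : E} (h : T.ActsBy Ψ α a) (hx : x ∈ T.rootSpace α)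
    (hv : Ψ v = (b : ℂ) • v) (n : ℕ) :
    Ψ (((LieAlgebra.ad ℂ E x) ^ n) v) = ((a ^ n * b : ℂˣ) : ℂ) • ((LieAlgebra.ad ℂ E x) ^ n) v := by
  induction n with
  | zero => simpa using hv
  | succ n ih =>
    rw [pow_succ', Module.End.mul_apply, LieAlgebra.ad_apply, LieEquiv.map_lie, ih, h x hx,
      smul_lie, lie_smul, smul_smul]
    congr 1
    push_cast
    ring

/-- The non-zero vector `f^(n+k) e^n v` lies on the line `E_{w_α β}`, and `Ψ` scales it by
`a^(-(n+k)) a^n b = b a^(-k)`. Negative `k` reduces to this by passing to `-α`. -/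
theorem ActsBy.reflect (hΨ : T.IsCartanAutomorphism Ψ) (hα : α ∈ T.nonisotropicRoots)
    (hβ : β ∈ T.nonisotropicRoots) {a b : ℂˣ} (ha : T.ActsBy Ψ α a) (hb : T.ActsBy Ψ β b) {k : ℤ}
    (hk : 2 * T.dualForm β α / T.dualForm α α = k) : T.ActsBy Ψ (β - k • α) (b * a ^ (-k)) := by
  wlog h : 0 ≤ k generalizing α a k
  · have := this (T.neg_mem_nonisotropicRoots hα) (ha.neg hΨ hα) (k := -k)
      (by rw [T.two_mul_dualForm_neg_div, hk]; push_cast; rfl) (by omega)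
    simpa using this
  lift k to ℕ using h
  have hw := T.reflect_mem_nonisotropicRoots hα hβ hk
  obtain ⟨e, he, f, hf, hef⟩ := T.exists_sl2_partner hα
  obtain ⟨v, hv, hv0⟩ := T.exists_ne_zero_of_mem_roots hβ.1
  obtain ⟨n, N, h, -, h2⟩ := T.exists_ladder hα he hf hef hv hv0
  rw [hk] at h
  have h' : (k : ℤ) + 2 * n = N := by exact_mod_cast h
  have h3 := h2 (n + k) (by omega)
  have h4 := T.ad_pow_mem_rootSpace hf (T.ad_pow_mem_rootSpace he hv n) (n + k)
  have h5 : β + (n : ℤ) • α + ((n + k : ℕ) : ℤ) • -α = β - (k : ℤ) • α := by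
    push_cast
    rw [smul_neg, add_smul]
    abel
  rw [h5] at h4
  refine ActsBy.of_ne_zero hw h4 h3 ?_
  rw [(ha.neg hΨ hα).ad_pow hf (ha.ad_pow he (hb v hv) n) (n + k)]
  congr 2
  rw [pow_add, zpow_neg, zpow_natCast, inv_pow, inv_pow, mul_comm b]
  group

/-! ### Index zero: from a reflectable base to a root-lattice character -/

variable (T)

theorem weylSubgroup_induction {P : Set T.CartanDual} (hP : P ⊆ T.nonisotropicRoots)
    {p : T.CartanDual → Prop}
    (h : ∀ γ ∈ P, ∀ β ∈ T.nonisotropicRoots, ∀ k : ℤ, 2 * T.dualForm β γ / T.dualForm γ γ = k →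
      p β → p (β - k • γ))
    {w : T.CartanDual ≃ₗ[ℂ] T.CartanDual} (hw : w ∈ T.weylSubgroup P) :
    ∀ β ∈ T.nonisotropicRoots, p β → w β ∈ T.nonisotropicRoots ∧ p (w β) := by
  have step : ∀ γ ∈ P, ∀ w : T.CartanDual ≃ₗ[ℂ] T.CartanDual, (∀ β : T.CartanDual,
      w β = β - (2 * T.dualForm β γ / T.dualForm γ γ) • γ) → ∀ β ∈ T.nonisotropicRoots, p β →
      w β ∈ T.nonisotropicRoots ∧ p (w β) := by
    intro γ hγ w hw β hβ hpβ
    obtain ⟨k, hk⟩ := T.exists_int_eq (hP hγ) hβ.1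
    rw [hw, hk, Int.cast_smul_eq_zsmul]
    exact ⟨T.reflect_mem_nonisotropicRoots (hP hγ) hβ hk, h γ hγ β hβ k hk hpβ⟩
  refine Subgroup.closure_induction'' (p := fun w _ => ∀ β ∈ T.nonisotropicRoots, p β →
    w β ∈ T.nonisotropicRoots ∧ p (w β)) ?_ ?_ ?_ ?_ hw
  · rintro w ⟨γ, hγ, hwγ⟩
    exact step γ hγ w hwγ
  · rintro w ⟨γ, hγ, hwγ⟩
    have hinv : w⁻¹ = w := by
      refine inv_eq_of_mul_eq_one_left (LinearEquiv.ext fun β => ?_)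
      have h2 := (hP hγ).2
      have h4 : T.dualForm (w β) γ = T.dualForm β γ - 2 * T.dualForm β γ := by
        rw [hwγ, ← T.dualFormHom_apply, map_sub, map_smul, T.dualFormHom_apply,
          T.dualFormHom_apply, smul_eq_mul, div_mul_cancel₀ _ h2]
      rw [LinearEquiv.mul_apply, hwγ (w β), h4, hwγ β, LinearEquiv.coe_one, id]
      have h3 : 2 * (T.dualForm β γ - 2 * T.dualForm β γ) / T.dualForm γ γ =
        -(2 * T.dualForm β γ / T.dualForm γ γ) := by ring
      rw [h3, neg_smul, sub_neg_eq_add, sub_add_cancel]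
    rw [hinv]
    exact step γ hγ w hwγ
  · exact fun β hβ hp => ⟨hβ, hp⟩
  · intro w₁ w₂ _ _ h1 h2 β hβ hp
    obtain ⟨h3, h4⟩ := h2 β hβ hp
    exact h1 _ h3 h4

/-- A reflectable set generates the root lattice. -/
theorem IsReflectableSet.closure_eq {P : Set T.CartanDual} (hP : T.IsReflectableSet P) :
    AddSubgroup.closure P = T.rootLattice := by
  refine le_antisymm (AddSubgroup.closure_mono fun α hα => (hP.1 hα).1) (T.rootLattice_le ?_)
  intro β hβ
  rw [← hP.2] at hβ
  obtain ⟨w, hw, α, hα, rfl⟩ := hβ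
  refine (T.weylSubgroup_induction hP.1 (p := fun β => β ∈ AddSubgroup.closure P) ?_ hw α
    (hP.1 hα) (AddSubgroup.subset_closure hα)).2
  intro γ hγ β _ k _ hβ
  exact sub_mem hβ (zsmul_mem (AddSubgroup.subset_closure hγ) k)

/-- The value of a root-lattice character at an element of the root lattice. -/
def RootLatticeCharacter.val {T : ExtendedAffineLieAlgebra E} (χ : T.RootLatticeCharacter)
    (γ : T.rootLattice) : ℂˣ := χ (Multiplicative.ofAdd γ)

/-- A root-lattice character which describes a Cartan automorphism `Ψ` on the non-isotropic root
spaces describes `Ψ` on the core. -/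
theorem eq_smul_of_mem_core {χ : T.RootLatticeCharacter}
    (hχ : ∀ α (h : α ∈ T.nonisotropicRoots),
      T.ActsBy Ψ α (χ.val ⟨α, AddSubgroup.subset_closure h.1⟩))
    (δ : T.rootLattice) (hx : x ∈ T.rootSpace δ) (hxc : x ∈ T.core) :
    Ψ x = (χ.val δ : ℂ) • x := by
  let U : T.rootLattice → Submodule ℂ E := fun γ =>
    { carrier := {x | x ∈ T.rootSpace γ ∧ Ψ x = (χ.val γ : ℂ) • x}
      add_mem' := fun ha hb => ⟨add_mem ha.1 hb.1, by rw [map_add, ha.2, hb.2, smul_add]⟩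
      zero_mem' := ⟨zero_mem _, by simp⟩
      smul_mem' := fun c x hx =>
        ⟨Submodule.smul_mem _ c hx.1, by rw [map_smul, hx.2, smul_comm]⟩ }
  -- The sum of the `U γ` contains the generators of the core and is closed under brackets.
  have hU : x ∈ ⨆ γ, U γ := by
    refine LieSubalgebra.lieSpan_induction (p := fun x _ => x ∈ ⨆ γ, U γ) ℂ ?_ ?_ ?_ ?_ ?_ hxc
    · intro y hy
      obtain ⟨α, hα, hyα⟩ := Set.mem_iUnion₂.1 hy
      exact Submodule.mem_iSup_of_mem ⟨α, AddSubgroup.subset_closure hα.1⟩ ⟨hyα, hχ α hα y hyα⟩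
    · exact zero_mem _
    · exact fun y z _ _ h1 h2 => add_mem h1 h2
    · exact fun a y _ h1 => Submodule.smul_mem _ a h1
    · intro y z _ _ h1 h2
      refine Submodule.iSup_induction U (motive := fun y => ⁅y, z⁆ ∈ ⨆ γ, U γ) h1 ?_ ?_ ?_
      · intro γ y hy
        refine Submodule.iSup_induction U (motive := fun z => ⁅y, z⁆ ∈ ⨆ γ, U γ) h2 ?_ ?_ ?_
        · intro γ' z hz
          refine Submodule.mem_iSup_of_mem (γ + γ') ⟨T.lie_mem_rootSpace hy.1 hz.1, ?_⟩
          rw [LieEquiv.map_lie, hy.2, hz.2, smul_lie, lie_smul, smul_smul]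
          simp [RootLatticeCharacter.val]
        · simp
        · intro a b ha hb
          rw [lie_add]
          exact add_mem ha hb
      · simp
      · intro a b ha hb
        rw [add_lie]
        exact add_mem ha hb
  -- Pairing with `E_{-δ}` isolates the component of weight `δ` and is faithful on `E_δ`.
  have hproj : ∃ u ∈ U δ, ∀ y ∈ T.rootSpace (-(δ : T.CartanDual)), T.form x y = T.form u y := by
    refine Submodule.iSup_induction U (motive := fun x => ∃ u ∈ U δ,
      ∀ y ∈ T.rootSpace (-(δ : T.CartanDual)), T.form x y = T.form u y) hU ?_ ?_ ?_
    · intro γ x hx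
      by_cases h : γ = δ
      · exact ⟨x, h ▸ hx, fun _ _ => rfl⟩
      · refine ⟨0, zero_mem _, fun y hy => ?_⟩
        rw [T.form_eq_zero_of_add_ne_zero hx.1 hy, map_zero, LinearMap.zero_apply]
        rw [← sub_eq_add_neg, sub_ne_zero]
        exact fun h' => h (Subtype.ext h')
    · exact ⟨0, zero_mem _, fun _ _ => rfl⟩
    · rintro a b ⟨u, hu, h1⟩ ⟨v, hv, h2⟩
      refine ⟨u + v, add_mem hu hv, fun y hy => ?_⟩
      rw [map_add, map_add, LinearMap.add_apply, LinearMap.add_apply, h1 y hy, h2 y hy]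
  obtain ⟨u, hu, h⟩ := hproj
  have hxu : x - u = 0 := T.eq_zero_of_form_eq_zero (sub_mem hx hu.1) fun y hy => by
    rw [map_sub, LinearMap.sub_apply, h y hy, sub_self]
  rw [sub_eq_zero.1 hxu]
  exact hu.2

/-- A finite-order Cartan automorphism described on the non-isotropic root spaces by a finite-order
root-lattice character is described by it on all root spaces. -/
theorem actsBy_of_pow_eq_one (hΨ : T.IsCartanAutomorphism Ψ) {N : ℕ} (hN : 0 < N)
    (hΨN : ∀ x, Ψ^[N] x = x) {χ : T.RootLatticeCharacter} (hχN : χ ^ N = 1)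
    (hχ : ∀ α (h : α ∈ T.nonisotropicRoots),
      T.ActsBy Ψ α (χ.val ⟨α, AddSubgroup.subset_closure h.1⟩))
    (α : T.CartanDual) (hα : α ∈ T.roots) :
    T.ActsBy Ψ α (χ.val ⟨α, AddSubgroup.subset_closure hα⟩) := by
  rcases T.mem_roots_cases hα with h | hδ
  · exact hχ α h
  intro x hx
  set c := χ.val ⟨α, AddSubgroup.subset_closure hα⟩ with hc
  have hcN : (c : ℂ) ^ N = 1 := by
    have : (χ ^ N) (Multiplicative.ofAdd ⟨α, AddSubgroup.subset_closure hα⟩) = 1 := by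
      rw [hχN, MonoidHom.one_apply]
    rw [MonoidHom.pow_apply] at this
    have h1 : c ^ N = 1 := this
    rw [← Units.val_pow_eq_pow_val, h1, Units.val_one]
  set z := Ψ x - (c : ℂ) • x with hz
  have hzα : z ∈ T.rootSpace α := sub_mem (hΨ.mem_rootSpace hx) (Submodule.smul_mem _ _ hx)
  -- For `β ∈ R^×`, `E_{α+β}` is zero or non-isotropic, so `Ψ` acts on `[x, y]` by `χ(α)χ(β)`.
  -- Cancelling `χ(β)` shows that `z` centralizes the core.
  have hzcore : z ∈ T.core := by
    refine T.tame z fun y hy => T.lie_core_eq_zero (fun β hβ y hy => ?_) hy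
    have h1 : ⁅x, y⁆ ∈ T.rootSpace (α + β) := T.lie_mem_rootSpace hx hy
    have h2 : Ψ ⁅x, y⁆ = (c : ℂ) • (χ.val ⟨β, AddSubgroup.subset_closure hβ.1⟩ : ℂ) • ⁅x, y⁆ := by
      by_cases hr : α + β ∈ T.roots
      · have hr' : α + β ∈ T.nonisotropicRoots := by
          rw [add_comm] at hr ⊢
          exact T.add_isotropic_mem hβ hδ hr
        rw [hχ _ hr' _ h1, smul_smul, hc, ← Units.val_mul]
        congr 2
        exact map_mul χ (Multiplicative.ofAdd ⟨α, AddSubgroup.subset_closure hα⟩)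
          (Multiplicative.ofAdd ⟨β, AddSubgroup.subset_closure hβ.1⟩)
      · rw [T.eq_zero_of_notMem_roots hr h1]
        simp
    rw [LieEquiv.map_lie, hχ β hβ y hy, lie_smul, smul_comm] at h2
    have h3 := smul_right_injective E (Units.ne_zero (χ.val ⟨β, AddSubgroup.subset_closure hβ.1⟩)) h2
    rw [hz, sub_lie, smul_lie, h3, sub_self]
  have hΨz := T.eq_smul_of_mem_core hχ ⟨α, AddSubgroup.subset_closure hα⟩ hzα hzcore
  rw [← hc] at hΨz
  -- Powers of the Jordan block on `x`, `z`; the extra factor `c` avoids the exponent `n - 1`. At `n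
  -- = N` only `N • z = 0` remains.
  have hiter : ∀ n : ℕ, (c : ℂ) • Ψ^[n] x = (c : ℂ) ^ n • ((c : ℂ) • x + (n : ℂ) • z) := by
    intro n
    induction n with
    | zero => simp
    | succ n ih =>
      have hx' : Ψ x = (c : ℂ) • x + z := by rw [hz]; abel
      rw [Function.iterate_succ_apply', ← map_smul, ih, map_smul, map_add, map_smul, map_smul, hΨz,
        hx', pow_succ, mul_smul]
      congr 1
      push_cast
      module
  have h1 := hiter N
  rw [hΨN, hcN, one_smul, left_eq_add] at h1
  have hz0 : z = 0 := (smul_eq_zero.1 h1).resolve_left (by exact_mod_cast hN.ne')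
  exact sub_eq_zero.1 hz0

/-- If the index is zero, the root lattice has a basis which is a reflectable base. -/
theorem exists_basis_of_ind_eq_zero (h : T.ind = 0) :
    ∃ P : Set T.CartanDual, T.IsReflectableSet P ∧
      ∃ b : Module.Basis P ℤ T.rootLattice, ∀ γ : P, (b γ : T.CartanDual) = γ := by
  have := T.rootLattice_free
  have := T.rootLattice_finite
  have hrefl : T.refl = Module.finrank ℤ T.rootLattice := by
    have : (T.refl : ℤ) - (Module.finrank ℤ T.rootLattice : ℤ) = 0 := h
    omega
  have hpos : 0 < Module.finrank ℤ T.rootLattice := by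
    obtain ⟨α, hα⟩ := T.nonisotropicRoots_nonempty
    have hne : Nontrivial T.rootLattice := by
      refine ⟨⟨α, AddSubgroup.subset_closure hα.1⟩, 0, fun h0 => hα.2 ?_⟩
      rw [show α = 0 from congrArg Subtype.val h0, T.dualForm_eq, LinearMap.zero_apply]
    exact Module.finrank_pos
  -- `sInf ∅ = 0` in `ℕ`, so positivity of `refl(R)` shows that the minimum is attained.
  have hmem : T.refl ∈ {n : ℕ | ∃ P : Set T.CartanDual, T.IsReflectableBase P ∧ P.encard = n} :=
    Nat.sInf_mem (Nat.nonempty_of_pos_sInf (by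
      change 0 < T.refl
      omega))
  obtain ⟨P, hP, hcard⟩ := hmem
  refine ⟨P, hP.1, ?_⟩
  have hcl := IsReflectableSet.closure_eq T hP.1
  have hfin : P.Finite := Set.finite_of_encard_eq_coe hcard
  have := hfin.fintype
  let v : P → T.rootLattice := fun γ => ⟨γ, AddSubgroup.subset_closure (hP.1.1 γ.2).1⟩
  have hspan : ⊤ ≤ Submodule.span ℤ (Set.range v) := by
    rintro ⟨x, hx⟩ -
    have hx' : x ∈ AddSubgroup.closure P := hcl ▸ hx
    induction hx' using AddSubgroup.closure_induction with
    | mem γ hγ => exact Submodule.subset_span ⟨⟨γ, hγ⟩, rfl⟩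
    | zero => exact zero_mem _
    | add a b ha hb h1 h2 => exact add_mem (h1 (hcl ▸ ha)) (h2 (hcl ▸ hb))
    | neg a ha h1 => exact neg_mem (h1 (hcl ▸ ha))
  have hcard' : Fintype.card P = Module.finrank ℤ T.rootLattice := by
    rw [← hrefl, ← Nat.cast_inj (R := ℕ∞), ← hcard, Set.encard_eq_coe_toFinset_card,
      Set.toFinset_card]
  refine ⟨Module.Basis.mk (linearIndependent_of_top_le_span_of_card_eq_finrank hspan hcard') hspan,
    fun γ => ?_⟩
  rw [Module.Basis.mk_apply]

theorem exists_rootLatticeCharacter_of_ind_eq_zero (h : T.ind = 0)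
    (hΨ : T.IsCartanAutomorphism Ψ) (hfin : IsFiniteOrderAut Ψ) :
    ∃ χ : T.RootLatticeCharacter, IsOfFinOrder χ ∧
      ∀ α : T.roots, ∀ x ∈ T.rootSpace α, Ψ x = (χ.onRoot α : ℂ) • x := by
  obtain ⟨N, hN, hΨN⟩ := hfin
  obtain ⟨P, hP, b, hb⟩ := T.exists_basis_of_ind_eq_zero h
  have hact : ∀ γ : P, ∃ a : ℂˣ, T.ActsBy Ψ γ a := fun γ => hΨ.exists_actsBy (hP.1 γ.2)
  choose a ha using hact
  have haN : ∀ γ, a γ ^ N = 1 := by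
    intro γ
    obtain ⟨x, hx, hx0⟩ := T.exists_ne_zero_of_mem_roots (hP.1 γ.2).1
    have h1 : ∀ n : ℕ, Ψ^[n] x = ((a γ : ℂ) ^ n) • x := by
      intro n
      induction n with
      | zero => simp
      | succ n ih =>
        rw [Function.iterate_succ_apply', ih, map_smul, ha γ x hx, smul_smul, pow_succ]
    have h2 := h1 N
    rw [hΨN] at h2
    have h3 : ((a γ : ℂ) ^ N - 1) • x = 0 := by rw [sub_smul, ← h2, one_smul, sub_self]
    exact Units.ext (by simpa using sub_eq_zero.1 ((smul_eq_zero.1 h3).resolve_right hx0))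
  let φ : T.rootLattice →ₗ[ℤ] Additive ℂˣ := b.constr ℤ fun γ => Additive.ofMul (a γ)
  let χ : T.RootLatticeCharacter := AddMonoidHom.toMultiplicativeLeft φ.toAddMonoidHom
  have hχ : ∀ γ, χ.val γ = (φ γ).toMul := fun γ => rfl
  have hχb : ∀ γ : P, χ.val (b γ) = a γ := by
    intro γ
    rw [hχ, Module.Basis.constr_basis]
    rfl
  have hNφ : N • φ = 0 := b.ext fun γ => by
    rw [LinearMap.smul_apply, Module.Basis.constr_basis, ← ofMul_pow, haN, ofMul_one,
      LinearMap.zero_apply]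
  have hχN : χ ^ N = 1 := by
    refine MonoidHom.ext fun γ => ?_
    have := LinearMap.congr_fun hNφ γ.toAdd
    exact congrArg Additive.toMul this
  refine ⟨χ, isOfFinOrder_iff_pow_eq_one.2 ⟨N, hN, hχN⟩, ?_⟩
  have hnon : ∀ α (h : α ∈ T.nonisotropicRoots),
      T.ActsBy Ψ α (χ.val ⟨α, AddSubgroup.subset_closure h.1⟩) := by
    have hbase : ∀ γ (hγ : γ ∈ P),
        T.ActsBy Ψ γ (χ.val ⟨γ, AddSubgroup.subset_closure (hP.1 hγ).1⟩) := by
      intro γ hγ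
      have : (⟨γ, AddSubgroup.subset_closure (hP.1 hγ).1⟩ : T.rootLattice) = b ⟨γ, hγ⟩ :=
        Subtype.ext (hb ⟨γ, hγ⟩).symm
      rw [this, hχb]
      exact ha ⟨γ, hγ⟩
    intro α hα
    have hα' := hα
    rw [← hP.2] at hα'
    obtain ⟨w, hw, γ, hγ, rfl⟩ := hα'
    -- Under the reflection in `γ`, both `χ` and the eigenvalue at `β` are multiplied by the value
    -- at `γ` to the power `-k`.
    have step : ∀ γ ∈ P, ∀ β ∈ T.nonisotropicRoots, ∀ k : ℤ,
        2 * T.dualForm β γ / T.dualForm γ γ = k →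
        (∃ h : β ∈ T.rootLattice, T.ActsBy Ψ β (χ.val ⟨β, h⟩)) →
        ∃ h : β - k • γ ∈ T.rootLattice, T.ActsBy Ψ (β - k • γ) (χ.val ⟨β - k • γ, h⟩) := by
      rintro γ hγ β hβ k hk ⟨h1, h2⟩
      have hγ' : γ ∈ T.rootLattice := AddSubgroup.subset_closure (hP.1 hγ).1
      refine ⟨sub_mem h1 (zsmul_mem hγ' k), ?_⟩
      have h3 := ActsBy.reflect hΨ (hP.1 hγ) hβ (hbase γ hγ) h2 hk
      convert h3 using 1
      have h4 : (⟨β - k • γ, sub_mem h1 (zsmul_mem hγ' k)⟩ : T.rootLattice) =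
        ⟨β, h1⟩ + (-k) • ⟨γ, hγ'⟩ := Subtype.ext (by simp [sub_eq_add_neg])
      rw [h4, RootLatticeCharacter.val, ofAdd_add, map_mul, ofAdd_zsmul, map_zpow]
      rfl
    obtain ⟨-, h1, h2⟩ := T.weylSubgroup_induction hP.1 step hw γ (hP.1 hγ)
      ⟨AddSubgroup.subset_closure (hP.1 hγ).1, hbase γ hγ⟩
    exact h2
  intro α
  exact T.actsBy_of_pow_eq_one hΨ hN hΨN hχN hnon α α.2

end ExtendedAffineLieAlgebra

/-- A lattice with roots, among them the real ones, whose coroots are integral, finite in number,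
and indecomposable; the other roots are orthogonal to all of them and non-isolated. -/
structure LatticeRootSystem (L : Type*) [AddCommGroup L] where
  roots : Set L
  real : Set L
  coroot : L → L →+ ℤ
  real_subset : real ⊆ roots
  zero_mem_roots : 0 ∈ roots
  neg_mem : ∀ {α}, α ∈ roots → -α ∈ roots
  coroot_self : ∀ {α}, α ∈ real → coroot α α = 2
  coroot_eq_zero : ∀ {α δ}, α ∈ real → δ ∈ roots → δ ∉ real → coroot α δ = 0
  sub_zsmul_mem : ∀ {α β}, α ∈ real → β ∈ roots → ∀ {j : ℤ}, 0 ≤ j → j ≤ coroot α β →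
    β - j • α ∈ roots
  two_zsmul_notMem : ∀ {α}, α ∈ real → (2 : ℤ) • α ∉ real
  reflect_mem : ∀ {α β}, α ∈ real → β ∈ real → β - coroot α β • α ∈ real
  coroot_reflect : ∀ {α β}, α ∈ real → β ∈ real → ∀ x,
    coroot (β - coroot α β • α) x = coroot β (x - coroot α x • α)
  sub_notMem_real : ∀ {α β}, α ∈ real → β ∈ real → coroot α = coroot β → α - β ∉ real
  exists_add_mem : ∀ {δ}, δ ∈ roots → δ ∉ real → ∃ α ∈ real, α + δ ∈ real
  indecomposable : ∀ R₁ R₂ : Set L, R₁ ∪ R₂ = real → Disjoint R₁ R₂ → R₁.Nonempty → R₂.Nonempty →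
    ∃ α ∈ R₁, ∃ β ∈ R₂, coroot α β ≠ 0
  finite_coroots : (coroot '' real).Finite
  closure_roots : AddSubgroup.closure roots = ⊤

/-! ### Abstract root systems: the Weyl-invariant semidefinite form -/

namespace LatticeRootSystem

variable {L : Type*} [AddCommGroup L] (R : LatticeRootSystem L) {α β γ δ x y z : L}

theorem neg_mem_real (h : α ∈ R.real) : -α ∈ R.real := by
  have := R.reflect_mem h h
  rw [R.coroot_self h] at this
  convert this using 1
  abel

theorem sub_mem (hα : α ∈ R.real) (hβ : β ∈ R.roots) (h : 0 < R.coroot α β) :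
    β - α ∈ R.roots := by
  have := R.sub_zsmul_mem hα hβ zero_le_one h
  rwa [one_smul] at this

/-- The coroot of `m • α` takes the value `2` on `m • α`, so `m` divides `2`; reducedness excludes
`m = 2`. -/
theorem eq_one_of_zsmul_mem {m : ℤ} (hm : 0 < m) (h : α ∈ R.real) (hmα : m • α ∈ R.real) :
    m = 1 := by
  have h1 := R.coroot_self hmα
  rw [map_zsmul, smul_eq_mul] at h1
  have h2 : m ≤ 2 := Int.le_of_dvd two_pos ⟨_, h1.symm⟩
  have h3 : m ≠ 2 := by
    rintro rfl
    exact R.two_zsmul_notMem h hmα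
  omega

/-- The reflection in a real root. -/
def reflection (α : L) : L →+ L where
  toFun x := x - R.coroot α x • α
  map_zero' := by simp
  map_add' x y := by
    rw [map_add, add_smul]
    abel

theorem reflection_apply (α x : L) : R.reflection α x = x - R.coroot α x • α := rfl

theorem reflection_reflection (h : α ∈ R.real) (x : L) :
    R.reflection α (R.reflection α x) = x := by
  rw [reflection_apply, reflection_apply, map_sub, map_zsmul, R.coroot_self h]
  module

/-- The Weyl-invariant form `∑ c, c x * c y` over all coroots `c`. -/
def form (x y : L) : ℤ := ∑ c ∈ R.finite_coroots.toFinset, c x * c y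

theorem form_comm (x y : L) : R.form x y = R.form y x :=
  Finset.sum_congr rfl fun _ _ => mul_comm _ _

theorem form_add_left (x y z : L) : R.form (x + y) z = R.form x z + R.form y z := by
  simp only [form, map_add, add_mul, Finset.sum_add_distrib]

theorem form_zsmul_left (n : ℤ) (x z : L) : R.form (n • x) z = n * R.form x z := by
  simp only [form, map_zsmul, smul_eq_mul, mul_assoc, Finset.mul_sum]

theorem form_add_right (x y z : L) : R.form z (x + y) = R.form z x + R.form z y := by
  rw [form_comm, form_add_left, form_comm, R.form_comm y]

theorem form_zsmul_right (n : ℤ) (x z : L) : R.form z (n • x) = n * R.form z x := by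
  rw [form_comm, form_zsmul_left, form_comm]

/-- The form as a homomorphism in its second argument. -/
def formHom (x : L) : L →+ ℤ where
  toFun := R.form x
  map_zero' := by simp [form]
  map_add' y z := R.form_add_right y z x

@[simp] theorem formHom_apply (x y : L) : R.formHom x y = R.form x y := rfl

/-- Composition with the reflection is an involution on the set of coroots, so it only permutes the
summands. -/
theorem form_reflection (h : α ∈ R.real) (x y : L) :
    R.form (R.reflection α x) (R.reflection α y) = R.form x y := by
  have hmap : ∀ c ∈ R.finite_coroots.toFinset,
      c.comp (R.reflection α) ∈ R.finite_coroots.toFinset := by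
    intro c hc
    obtain ⟨β, hβ, rfl⟩ := R.finite_coroots.mem_toFinset.1 hc
    refine R.finite_coroots.mem_toFinset.2 ⟨_, R.reflect_mem h hβ, ?_⟩
    ext x
    exact R.coroot_reflect h hβ x
  have hinv : ∀ c : L →+ ℤ, (c.comp (R.reflection α)).comp (R.reflection α) = c := by
    intro c
    ext x
    exact congrArg c (R.reflection_reflection h x)
  exact Finset.sum_nbij' (fun c => c.comp (R.reflection α)) (fun c => c.comp (R.reflection α))
    hmap hmap (fun c _ => hinv c) (fun c _ => hinv c) fun _ _ => rfl

theorem form_self_nonneg (x : L) : 0 ≤ R.form x x :=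
  Finset.sum_nonneg fun _ _ => mul_self_nonneg _

theorem form_self_pos (h : α ∈ R.real) : 0 < R.form α α := by
  refine Finset.sum_pos' (fun _ _ => mul_self_nonneg _)
    ⟨R.coroot α, R.finite_coroots.mem_toFinset.2 ⟨α, h, rfl⟩, ?_⟩
  rw [R.coroot_self h]
  norm_num

theorem coroot_eq_zero_of_form_self (h : R.form x x = 0) (hα : α ∈ R.real) :
    R.coroot α x = 0 :=
  mul_self_eq_zero.1 ((Finset.sum_eq_zero_iff_of_nonneg fun _ _ => mul_self_nonneg _).1 h _
    (R.finite_coroots.mem_toFinset.2 ⟨α, hα, rfl⟩))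

/-- Invariance compares `(x, α)` with `(s_α x, -α)`. Signs and vanishing of coroots can thus be read
off a symmetric form. -/
theorem two_mul_form (h : α ∈ R.real) (x : L) :
    2 * R.form x α = R.coroot α x * R.form α α := by
  have h1 := R.form_reflection h x α
  have h2 : R.reflection α α = (-1 : ℤ) • α := by
    rw [reflection_apply, R.coroot_self h]
    module
  rw [h2, form_zsmul_right, reflection_apply, sub_eq_add_neg, ← neg_smul, form_add_left,
    form_zsmul_left] at h1
  linarith

theorem coroot_pos_iff (h : α ∈ R.real) : 0 < R.coroot α x ↔ 0 < R.form x α := by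
  have h1 := R.two_mul_form h x
  have h2 := R.form_self_pos h
  rw [← mul_pos_iff_of_pos_right h2, ← h1]
  omega

theorem coroot_eq_zero_iff (h : α ∈ R.real) : R.coroot α x = 0 ↔ R.form x α = 0 := by
  have h1 := R.two_mul_form h x
  have h2 := (R.form_self_pos h).ne'
  constructor
  · intro h0
    rw [h0] at h1
    omega
  · intro h0
    rw [h0, mul_zero] at h1
    exact (mul_eq_zero.1 h1.symm).resolve_right h2

theorem coroot_nonpos_iff (h : α ∈ R.real) : R.coroot α x ≤ 0 ↔ R.form x α ≤ 0 := by
  rw [← not_lt, R.coroot_pos_iff h, not_lt]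

/-- Translation of real roots by multiples of an imaginary root. -/
theorem add_zsmul_mem_real (hδ : δ ∈ R.roots) (hδ' : δ ∉ R.real) (hα : α ∈ R.real)
    (hαδ : α + δ ∈ R.real) (k : ℤ) : α + k • δ ∈ R.real := by
  -- Reflecting in `α` and negating gives `k ↦ -k`; doing so with `α + δ` gives `k ↦ 2 - k`. Their
  -- composite shifts `k` by `2`, starting from `0` and `1`.
  have h1 : ∀ k : ℤ, α + k • δ ∈ R.real → α + (-k) • δ ∈ R.real := by
    intro k hk
    have := R.neg_mem_real (R.reflect_mem hα hk)
    rw [map_add, map_zsmul, R.coroot_self hα, R.coroot_eq_zero hα hδ hδ'] at this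
    convert this using 1
    module
  have h2 : ∀ k : ℤ, α + k • δ ∈ R.real → α + (2 - k) • δ ∈ R.real := by
    intro k hk
    have h0 : α + k • δ = (α + δ) + (k - 1) • δ := by module
    have := R.neg_mem_real (R.reflect_mem hαδ hk)
    rw [h0, map_add, map_zsmul, R.coroot_self hαδ, R.coroot_eq_zero hαδ hδ hδ'] at this
    convert this using 1
    module
  have h3 : ∀ n : ℕ, α + (n : ℤ) • δ ∈ R.real := by
    intro n
    induction n using Nat.twoStepInduction with
    | zero => simpa using hα
    | one => simpa using hαδ
    | more n ih _ =>
      have := h2 _ (h1 _ ih)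
      convert this using 3
      push_cast
      ring
  obtain ⟨n, rfl | rfl⟩ := k.eq_nat_or_neg
  · exact h3 n
  · exact h1 n (h3 n)

/-! ### Positive systems and the independence of simple roots -/

section Positive

variable (f : L →+ ℝ)

/-- The roots on which `f` is positive. -/
def positive : Set L := {α ∈ R.roots | 0 < f α}

/-- The positive roots which are not a sum of two positive roots. -/
def simple : Set L := {α ∈ R.positive f | ∀ β ∈ R.positive f, ∀ γ ∈ R.positive f, α ≠ β + γ}

variable {f} {d : L}

/-- Real roots with the same coroot differ by imaginary roots, so they lie in one coset of `ℤd`.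
There are finitely many coroots, and `f` takes values in `(0, K]` at only finitely many points of
each coset. This is where nullity at most one enters. -/
theorem finite_positive (hf : Function.Injective f)
    (hd : ∀ δ ∈ R.roots, δ ∉ R.real → ∃ k : ℤ, δ = k • d) (K : ℝ) :
    {α ∈ R.positive f | f α ≤ K}.Finite := by
  have hcoset : ∀ a : L, {x : L | (∃ k : ℤ, x = a + k • d) ∧ 0 < f x ∧ f x ≤ K}.Finite := by
    intro a
    by_cases h0 : d = 0
    · refine (Set.finite_singleton a).subset ?_
      rintro x ⟨⟨k, rfl⟩, -⟩
      simp [h0]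
    have hfd : 0 < |f d| := abs_pos.2 fun h => h0 (hf (by rw [h, map_zero]))
    obtain ⟨n, hn⟩ := exists_nat_gt ((K + |f a|) / |f d|)
    refine ((Set.finite_Icc (-(n : ℤ)) n).image fun k => a + k • d).subset ?_
    rintro x ⟨⟨k, rfl⟩, h1, h2⟩
    refine ⟨k, ?_, rfl⟩
    rw [map_add, map_zsmul, zsmul_eq_mul] at h1 h2
    have h3 : |(k : ℝ)| * |f d| ≤ K + |f a| := by
      rw [← abs_mul, abs_le]
      constructor <;> linarith [neg_abs_le (f a), le_abs_self (f a)]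
    rw [div_lt_iff₀ hfd] at hn
    have h4 : |(k : ℝ)| < n := lt_of_mul_lt_mul_right (h3.trans_lt hn) hfd.le
    have h5 : |k| < n := by exact_mod_cast h4
    exact ⟨(abs_lt.1 h5).1.le, (abs_lt.1 h5).2.le⟩
  have hrep : ∀ c ∈ R.coroot '' R.real, ∃ a : L, ∀ α ∈ R.real, R.coroot α = c →
      ∃ k : ℤ, α = a + k • d := by
    rintro c ⟨a, ha, rfl⟩
    refine ⟨a, fun α hα h => ?_⟩
    have h1 : α - a ∈ R.roots :=
      R.sub_mem ha (R.real_subset hα) (by rw [← h, R.coroot_self hα]; norm_num)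
    obtain ⟨k, hk⟩ := hd _ h1 (R.sub_notMem_real hα ha h)
    exact ⟨k, by rw [← hk]; abel⟩
  choose! a ha using hrep
  refine ((hcoset 0).union (R.finite_coroots.biUnion fun c _ => hcoset (a c))).subset ?_
  rintro α ⟨⟨hα, h1⟩, h2⟩
  by_cases h : α ∈ R.real
  · refine Or.inr (Set.mem_biUnion ⟨α, h, rfl⟩ ⟨?_, h1, h2⟩)
    exact ha _ ⟨α, h, rfl⟩ α h rfl
  · refine Or.inl ⟨?_, h1, h2⟩
    simpa using hd α hα h

/-- Finiteness below every bound makes the order by `f` well-founded on positive roots. -/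
theorem positive_induction (hfin : ∀ K : ℝ, {α ∈ R.positive f | f α ≤ K}.Finite)
    {p : L → Prop}
    (h : ∀ α ∈ R.positive f, (∀ β ∈ R.positive f, f β < f α → p β) → p α) :
    ∀ α ∈ R.positive f, p α := by
  by_contra! hcon
  obtain ⟨α, hα, hpα⟩ := hcon
  have hne : {β | (β ∈ R.positive f ∧ f β ≤ f α) ∧ ¬ p β}.Nonempty := ⟨α, ⟨hα, le_rfl⟩, hpα⟩
  obtain ⟨β, ⟨⟨hβ, hβα⟩, hpβ⟩, hmin⟩ :=
    Set.exists_min_image _ f ((hfin (f α)).subset fun β hβ => hβ.1) hne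
  refine hpβ (h β hβ fun γ hγ hlt => ?_)
  by_contra hpγ
  exact absurd (hmin γ ⟨⟨hγ, (hlt.le.trans hβα)⟩, hpγ⟩) (not_le.2 hlt)

theorem positive_mem_closure (hfin : ∀ K : ℝ, {α ∈ R.positive f | f α ≤ K}.Finite) :
    ∀ α ∈ R.positive f, α ∈ AddSubmonoid.closure (R.simple f) := by
  refine R.positive_induction hfin fun α hα ih => ?_
  by_cases hs : α ∈ R.simple f
  · exact AddSubmonoid.subset_closure hs
  · have : ∃ β ∈ R.positive f, ∃ γ ∈ R.positive f, α = β + γ := by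
      by_contra! hcon
      exact hs ⟨hα, hcon⟩
    obtain ⟨β, hβ, γ, hγ, rfl⟩ := this
    refine add_mem (ih β hβ ?_) (ih γ hγ ?_)
    · rw [map_add]
      linarith [hγ.2]
    · rw [map_add]
      linarith [hβ.2]

theorem positive_or_neg (hf : Function.Injective f) (hα : α ∈ R.roots) (h0 : α ≠ 0) :
    α ∈ R.positive f ∨ -α ∈ R.positive f := by
  rcases lt_trichotomy (f α) 0 with h | h | h
  · exact Or.inr ⟨R.neg_mem hα, by rw [map_neg]; linarith⟩
  · exact absurd (hf (by rw [h, map_zero])) h0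
  · exact Or.inl ⟨hα, h⟩

theorem closure_simple (hf : Function.Injective f)
    (hfin : ∀ K : ℝ, {α ∈ R.positive f | f α ≤ K}.Finite) :
    AddSubgroup.closure (R.simple f) = ⊤ := by
  rw [eq_top_iff, ← R.closure_roots, AddSubgroup.closure_le]
  have hle : ∀ α ∈ R.positive f, α ∈ AddSubgroup.closure (R.simple f) := fun α hα =>
    AddSubgroup.le_closure_toAddSubmonoid _ (R.positive_mem_closure hfin α hα)
  intro α hα
  by_cases h0 : α = 0
  · rw [h0]
    exact zero_mem _
  rcases R.positive_or_neg hf hα h0 with h | h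
  · exact hle α h
  · exact neg_mem_iff.1 (hle _ h)

/-- For a positive imaginary `δ`, some string `α + ℤδ` is real. Its member with `f`-value in `[0, f
δ)` is non-zero, and it splits `δ` into two positive real roots. -/
theorem simple_subset_real (hf : Function.Injective f) : R.simple f ⊆ R.real := by
  rintro δ ⟨⟨hδ, hpos⟩, hs⟩
  by_contra hδ'
  obtain ⟨α, hα, hαδ⟩ := R.exists_add_mem hδ hδ'
  have hall := R.add_zsmul_mem_real hδ hδ' hα hαδ
  have hr := Int.floor_le (f α / f δ)
  have hr' := Int.lt_floor_add_one (f α / f δ)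
  set n := ⌊f α / f δ⌋ with hn
  rw [le_div_iff₀ hpos] at hr
  rw [div_lt_iff₀ hpos] at hr'
  have hβ := hall (-n)
  have hne : f (α + (-n) • δ) ≠ 0 := by
    intro h0
    have h1 : α + (-n) • δ = 0 := hf (by rw [h0, map_zero])
    have h2 := R.coroot_self hβ
    rw [h1, map_zero] at h2
    omega
  have hfβ : f (α + (-n) • δ) = f α - n * f δ := by
    rw [map_add, map_zsmul, zsmul_eq_mul]
    push_cast
    ring
  have hγ : δ - (α + (-n) • δ) ∈ R.real := by
    have := R.neg_mem_real (hall (-n - 1))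
    convert this using 1
    module
  refine hs _ ⟨R.real_subset hβ, lt_of_le_of_ne ?_ hne.symm⟩ _ ⟨R.real_subset hγ, ?_⟩
    (add_sub_cancel _ _).symm
  · rw [hfβ]
    linarith
  · rw [map_sub, hfβ]
    linarith

theorem sub_notMem_roots (hf : Function.Injective f) (hα : α ∈ R.simple f) (hβ : β ∈ R.simple f)
    (hne : α ≠ β) : α - β ∉ R.roots := by
  intro h
  rcases R.positive_or_neg hf h (sub_ne_zero.2 hne) with h1 | h1
  · exact hα.2 _ h1 _ hβ.1 (sub_add_cancel _ _).symm
  · rw [neg_sub] at h1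
    exact hβ.2 _ h1 _ hα.1 (sub_add_cancel _ _).symm

/-- A positive product would make `α - β` a root, and then one of the two simple roots would be a
sum of positive roots. -/
theorem form_simple_nonpos (hf : Function.Injective f) (hα : α ∈ R.simple f)
    (hβ : β ∈ R.simple f) (hne : α ≠ β) : R.form α β ≤ 0 := by
  have hβ' := R.simple_subset_real hf hβ
  rw [← R.coroot_nonpos_iff hβ']
  by_contra! hpos
  exact R.sub_notMem_roots hf hα hβ hne (R.sub_mem hβ' hα.1.1 hpos)

/-- A positive real root is simple or can be lowered by the reflection in a simple root. -/
theorem exists_lowering (hf : Function.Injective f)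
    (hfin : ∀ K : ℝ, {α ∈ R.positive f | f α ≤ K}.Finite) (hβ : β ∈ R.positive f)
    (hβ' : β ∈ R.real) (hs : β ∉ R.simple f) :
    ∃ α ∈ R.simple f, 0 < R.coroot α β ∧ R.reflection α β ∈ R.positive f ∧
      R.reflection α β ∈ R.real ∧ f (R.reflection α β) < f β := by
  obtain ⟨α, hα, hpos⟩ : ∃ α ∈ R.simple f, 0 < R.form β α := by
    -- `β` is a sum of simple roots and `(β, β) > 0`, so some simple root pairs positively with it.
    by_contra! hcon
    have : ∀ x ∈ AddSubmonoid.closure (R.simple f), R.form β x ≤ 0 := by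
      intro x hx
      induction hx using AddSubmonoid.closure_induction with
      | mem x hx => exact hcon x hx
      | zero => exact (map_zero (R.formHom β)).le
      | add x y _ _ h1 h2 =>
        rw [form_add_right]
        linarith
    have h1 := this β (R.positive_mem_closure hfin β hβ)
    have h2 := R.form_self_pos hβ'
    omega
  have hα' := R.simple_subset_real hf hα
  have hc := (R.coroot_pos_iff hα').2 hpos
  have hfα : 0 < f α := hα.1.2
  -- The string down from `β` cannot leave the positive roots: at the crossing, `α` would be the sum
  -- of `β - jα` and `(j + 1)α - β`. Passing through zero would make `β` a multiple of `α`, hence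
  -- `α` itself.
  have hlow : ∀ j : ℕ, (j : ℤ) ≤ R.coroot α β → β - (j : ℤ) • α ∈ R.positive f := by
    intro j
    induction j with
    | zero => simpa using fun _ => hβ
    | succ j ih =>
      intro hj
      push_cast at hj ⊢
      have h1 : β - ((j : ℤ) + 1) • α ∈ R.roots :=
        R.sub_zsmul_mem hα' hβ.1 (by omega) hj
      refine (R.positive_or_neg hf h1 fun h0 => ?_).resolve_right fun h2 => ?_
      · rw [sub_eq_zero] at h0
        have h3 := R.eq_one_of_zsmul_mem (by omega) hα' (h0 ▸ hβ')
        rw [h3, one_smul] at h0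
        exact hs (h0 ▸ hα)
      · refine hα.2 _ h2 _ (ih (by omega)) ?_
        module
  have hlast := hlow (R.coroot α β).toNat (by rw [Int.toNat_of_nonneg hc.le])
  rw [Int.toNat_of_nonneg hc.le] at hlast
  refine ⟨α, hα, hc, hlast, R.reflect_mem hα' hβ', ?_⟩
  · rw [reflection_apply, map_sub, map_zsmul, zsmul_eq_mul]
    have : (0 : ℝ) < R.coroot α β := by exact_mod_cast hc
    nlinarith

/-- Every real root is orthogonal to one of two orthogonal parts of the simple roots. -/
theorem orthogonal_or_orthogonal (hf : Function.Injective f)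
    (hfin : ∀ K : ℝ, {α ∈ R.positive f | f α ≤ K}.Finite) {S : Set L}
    (horth : ∀ α ∈ R.simple f, ∀ γ ∈ R.simple f, α ∈ S → γ ∉ S → R.form α γ = 0)
    (hβ : β ∈ R.real) :
    (∀ α ∈ R.simple f, α ∈ S → R.form β α = 0) ∨ (∀ α ∈ R.simple f, α ∉ S → R.form β α = 0) := by
  have hpos : ∀ β ∈ R.positive f, β ∈ R.real → (∀ α ∈ R.simple f, α ∈ S → R.form β α = 0) ∨
      (∀ α ∈ R.simple f, α ∉ S → R.form β α = 0) := by
    refine R.positive_induction hfin fun β hβ ih hβ' => ?_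
    by_cases hs : β ∈ R.simple f
    · by_cases hβS : β ∈ S
      · exact Or.inr fun γ hγ hγS => horth β hs γ hγ hβS hγS
      · refine Or.inl fun γ hγ hγS => ?_
        rw [form_comm]
        exact horth γ hγ β hs hγS hβS
    obtain ⟨α, hα, hc, hp, hr, hlt⟩ := R.exists_lowering hf hfin hβ hβ' hs
    have hα' := R.simple_subset_real hf hα
    -- The lowering root `α` thus avoids the part orthogonal to `s_α β`, so adding it back preserves
    -- that orthogonality.
    have hne : R.form (R.reflection α β) α ≠ 0 := by
      rw [Ne, ← R.coroot_eq_zero_iff hα', reflection_apply, map_sub, map_zsmul,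
        R.coroot_self hα', smul_eq_mul]
      omega
    have hβeq : ∀ γ, R.form α γ = 0 → R.form (R.reflection α β) γ = 0 → R.form β γ = 0 := by
      intro γ h1 h2
      rwa [reflection_apply, sub_eq_add_neg, ← neg_smul, form_add_left, form_zsmul_left, h1,
        mul_zero, add_zero] at h2
    rcases ih _ hp hlt hr with h | h
    · refine Or.inl fun γ hγ hγS => hβeq γ ?_ (h γ hγ hγS)
      have hαS : α ∉ S := fun hαS => hne (h α hα hαS)
      rw [form_comm]
      exact horth γ hγ α hα hγS hαS
    · refine Or.inr fun γ hγ hγS => hβeq γ ?_ (h γ hγ hγS)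
      have hαS : α ∈ S := by
        by_contra hαS
        exact hne (h α hα hαS)
      exact horth α hα γ hγ hαS hγS
  have hβ0 : β ≠ 0 := by
    rintro rfl
    have := R.coroot_self hβ
    rw [map_zero] at this
    omega
  rcases R.positive_or_neg hf (R.real_subset hβ) hβ0 with h | h
  · exact hpos β h hβ
  · have hneg : ∀ γ, R.form (-β) γ = 0 → R.form β γ = 0 := by
      intro γ h
      rw [← neg_one_zsmul, form_zsmul_left] at h
      omega
    exact (hpos _ h (R.neg_mem_real hβ)).imp (fun h γ hγ hS => hneg γ (h γ hγ hS))
      (fun h γ hγ hS => hneg γ (h γ hγ hS))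

/-- The simple roots do not split into two non-empty orthogonal parts. -/
theorem simple_indecomposable (hf : Function.Injective f)
    (hfin : ∀ K : ℝ, {α ∈ R.positive f | f α ≤ K}.Finite) {S : Set L}
    (hS : ∃ α ∈ R.simple f, α ∈ S) (hS' : ∃ α ∈ R.simple f, α ∉ S) :
    ∃ α ∈ R.simple f, ∃ γ ∈ R.simple f, α ∈ S ∧ γ ∉ S ∧ R.form α γ ≠ 0 := by
  by_contra! hcon
  have horth : ∀ α ∈ R.simple f, ∀ γ ∈ R.simple f, α ∈ S → γ ∉ S → R.form α γ = 0 := hcon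
  obtain ⟨α₁, hα₁, hα₁S⟩ := hS
  obtain ⟨α₂, hα₂, hα₂S⟩ := hS'
  have hunion : {β | β ∈ R.real ∧ ∃ α ∈ R.simple f, α ∈ S ∧ R.form β α ≠ 0} ∪
      {β | β ∈ R.real ∧ ∀ α ∈ R.simple f, α ∈ S → R.form β α = 0} = R.real := by
    ext β
    constructor
    · rintro (h | h)
      · exact h.1
      · exact h.1
    · intro h
      by_cases h0 : ∃ α ∈ R.simple f, α ∈ S ∧ R.form β α ≠ 0
      · exact Or.inl ⟨h, h0⟩
      · push Not at h0
        exact Or.inr ⟨h, h0⟩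
  have hdisj : Disjoint {β | β ∈ R.real ∧ ∃ α ∈ R.simple f, α ∈ S ∧ R.form β α ≠ 0}
      {β | β ∈ R.real ∧ ∀ α ∈ R.simple f, α ∈ S → R.form β α = 0} := by
    refine Set.disjoint_left.2 ?_
    rintro β ⟨-, α, hα, hαS, h1⟩ ⟨-, h2⟩
    exact h1 (h2 α hα hαS)
  obtain ⟨β, ⟨hβ, α₀, hα₀, hα₀S, hβα⟩, γ, ⟨hγ, hγS⟩, hβγ⟩ := R.indecomposable _ _ hunion hdisj
    ⟨α₁, R.simple_subset_real hf hα₁, α₁, hα₁, hα₁S,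
      (R.form_self_pos (R.simple_subset_real hf hα₁)).ne'⟩
    ⟨α₂, R.simple_subset_real hf hα₂, fun α hα hαS => by
      rw [form_comm]
      exact horth α hα α₂ hα₂ hαS hα₂S⟩
  have hβS : ∀ α ∈ R.simple f, α ∉ S → R.form β α = 0 :=
    (R.orthogonal_or_orthogonal hf hfin horth hβ).resolve_left fun h => hβα (h α₀ hα₀ hα₀S)
  have hvanish : ∀ (M : Set L) (x : L), (∀ α ∈ M, R.form x α = 0) →
      ∀ y ∈ AddSubgroup.closure M, R.form x y = 0 := fun M x h y hy =>
    (AddSubgroup.closure_le (R.formHom x).ker).2 h hy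
  have hdec : ∀ x : L, ∃ x₁ ∈ AddSubgroup.closure (R.simple f ∩ S),
      ∃ x₂ ∈ AddSubgroup.closure (R.simple f \ S), x₁ + x₂ = x := by
    intro x
    rw [← AddSubgroup.mem_sup, ← AddSubgroup.closure_union, Set.inter_union_sdiff,
      R.closure_simple hf hfin]
    trivial
  have hcross : ∀ x ∈ AddSubgroup.closure (R.simple f ∩ S),
      ∀ y ∈ AddSubgroup.closure (R.simple f \ S), R.form x y = 0 := by
    intro x hx
    refine hvanish _ x fun y hy => ?_
    rw [form_comm]
    refine hvanish _ y (fun z hz => ?_) x hx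
    rw [form_comm]
    exact horth z hz.1 y hy.1 hz.2 hy.2
  -- The form is only semidefinite, so `β₂` and `γ₁` need not vanish; instead all contributions to
  -- `(β, γ)` are shown to be zero.
  obtain ⟨β₁, hβ₁, β₂, hβ₂, hβeq⟩ := hdec β
  obtain ⟨γ₁, hγ₁, γ₂, hγ₂, hγeq⟩ := hdec γ
  have h1 : R.form γ β₁ = 0 := hvanish _ γ (fun α hα => hγS α hα.1 hα.2) β₁ hβ₁
  have h2 : R.form β γ₂ = 0 := hvanish _ β (fun α hα => hβS α hα.1 hα.2) γ₂ hγ₂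
  have h3 := hcross β₁ hβ₁ γ₂ hγ₂
  have h4 := hcross γ₁ hγ₁ β₂ hβ₂
  rw [← hβeq, form_add_left, h3, zero_add] at h2
  refine hβγ ((R.coroot_eq_zero_iff hβ).2 ?_)
  rw [← hβeq, form_add_right, h1, zero_add, ← hγeq, form_add_left, h4, zero_add, form_comm, h2]

/-- The simple roots are linearly independent. -/
theorem linearIndependent_simple (hf : Function.Injective f)
    (hfin : ∀ K : ℝ, {α ∈ R.positive f | f α ≤ K}.Finite) :
    LinearIndependent ℤ (Subtype.val : R.simple f → L) := by
  classical
  rw [linearIndependent_iff']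
  intro s g hg
  by_contra! hcon
  obtain ⟨i₀, hi₀, hgi₀⟩ := hcon
  set I := s.filter fun i => 0 < g i with hI
  set J := s.filter fun i => ¬ 0 < g i with hJ
  have hIJ : ∑ i ∈ I, g i • (i : L) + ∑ i ∈ J, g i • (i : L) = 0 := by
    rw [Finset.sum_filter_add_sum_filter_not, hg]
  have hIJ' : ∑ i ∈ I, g i • (i : L) = ∑ i ∈ J, (-g i) • (i : L) := by
    rw [eq_neg_of_add_eq_zero_left hIJ, ← Finset.sum_neg_distrib]
    simp only [neg_smul]
  set v := ∑ i ∈ I, g i • (i : L) with hv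
  have hfpos : ∀ i : R.simple f, 0 < f i := fun i => i.2.1.2
  have hfI : f v = ∑ i ∈ I, (g i : ℝ) * f i := by
    simp [hv, map_sum]
  have hfJ : f v = ∑ i ∈ J, (-g i : ℝ) * f i := by
    rw [hIJ']
    simp [map_sum]
  have hgI : ∀ i ∈ I, 0 < g i := fun i hi => (Finset.mem_filter.1 hi).2
  have hgJ : ∀ i ∈ J, g i ≤ 0 := fun i hi => not_lt.1 (Finset.mem_filter.1 hi).2
  have hfv : 0 < f v := by
    by_cases hi : i₀ ∈ I
    · rw [hfI]
      refine Finset.sum_pos (fun i hi => mul_pos ?_ (hfpos i)) ⟨i₀, hi⟩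
      exact_mod_cast hgI i hi
    · rw [hfJ]
      have hi' : i₀ ∈ J := Finset.mem_filter.2 ⟨hi₀, fun h => hi (Finset.mem_filter.2 ⟨hi₀, h⟩)⟩
      refine Finset.sum_pos' (fun i hi => mul_nonneg ?_ (hfpos i).le)
        ⟨i₀, hi', mul_pos ?_ (hfpos i₀)⟩
      · have := hgJ i hi
        exact_mod_cast neg_nonneg.2 this
      · have := lt_of_le_of_ne (hgJ i₀ hi') hgi₀
        exact_mod_cast neg_pos.2 this
  have hIne : I.Nonempty := by
    rw [Finset.nonempty_iff_ne_empty]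
    intro h
    rw [hfI, h, Finset.sum_empty] at hfv
    exact lt_irrefl _ hfv
  have hJne : J.Nonempty := by
    rw [Finset.nonempty_iff_ne_empty]
    intro h
    rw [hfJ, h, Finset.sum_empty] at hfv
    exact lt_irrefl _ hfv
  have hform : ∀ x, R.form x v = ∑ i ∈ I, g i * R.form x i := by
    intro x
    rw [← formHom_apply, hv, map_sum]
    simp only [formHom_apply, form_zsmul_right]
  have hformJ : ∀ x, R.form x v = ∑ i ∈ J, -g i * R.form x i := by
    intro x
    rw [← formHom_apply, hIJ', map_sum]
    simp only [formHom_apply, form_zsmul_right]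
  -- Pairing the expression of `v` over `I` with that over `J` involves only distinct simple roots,
  -- so `(v, v) ≤ 0`.
  have hvv : R.form v v = 0 := by
    refine le_antisymm ?_ (R.form_self_nonneg v)
    rw [hformJ]
    refine Finset.sum_nonpos fun j hj => mul_nonpos_of_nonneg_of_nonpos
      (neg_nonneg.2 (hgJ j hj)) ?_
    rw [form_comm, hform]
    refine Finset.sum_nonpos fun i hi => mul_nonpos_of_nonneg_of_nonpos (hgI i hi).le ?_
    refine R.form_simple_nonpos hf j.2 i.2 fun h => ?_
    have h1 := hgJ j hj
    have h2 := hgI i hi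
    rw [Subtype.ext h] at h1
    omega
  obtain ⟨i, hi⟩ := hIne
  obtain ⟨j, hj⟩ := hJne
  have hjI : j ∉ I := fun h => absurd (hgI j h) (not_lt.2 (hgJ j hj))
  -- Connectedness links a root of `I` to a simple `γ` outside `I`. As `v` is in the radical, `0 =
  -- (γ, v)` is a sum of non-positive terms, so this link must vanish.
  obtain ⟨α, hα, γ, hγ, hαS, hγS, hαγ⟩ := R.simple_indecomposable hf hfin
    (S := Subtype.val '' (I : Set (R.simple f))) ⟨i, i.2, i, hi, rfl⟩
    ⟨j, j.2, fun ⟨k, hk, hkj⟩ => hjI (Subtype.ext hkj ▸ hk)⟩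
  obtain ⟨a, ha, rfl⟩ := hαS
  have hγ0 : R.form γ v = 0 := by
    have hγ' := R.simple_subset_real hf hγ
    rw [form_comm, ← R.coroot_eq_zero_iff hγ']
    exact R.coroot_eq_zero_of_form_self hvv hγ'
  rw [hform] at hγ0
  have hle : ∀ i ∈ I, g i * R.form γ i ≤ 0 := by
    intro i hi
    refine mul_nonpos_of_nonneg_of_nonpos (hgI i hi).le (R.form_simple_nonpos hf hγ i.2 ?_)
    rintro rfl
    exact hγS ⟨i, hi, rfl⟩
  have h0 := (Finset.sum_eq_zero_iff_of_nonpos hle).1 hγ0 a ha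
  refine hαγ ?_
  rw [form_comm]
  exact (mul_eq_zero.1 h0).resolve_left (hgI a ha).ne'

/-- If the imaginary roots lie in a cyclic group, every partially additive map on the roots extends
to a homomorphism. -/
theorem exists_extension {A : Type*} [AddCommGroup A] (hf : Function.Injective f)
    (hd : ∀ δ ∈ R.roots, δ ∉ R.real → ∃ k : ℤ, δ = k • d) (ψ : L → A)
    (hψ : ∀ α ∈ R.roots, ∀ β ∈ R.roots, α + β ∈ R.roots → ψ (α + β) = ψ α + ψ β) :
    ∃ χ : L →+ A, ∀ α ∈ R.roots, χ α = ψ α := by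
  have hfin := R.finite_positive hf hd
  have hspan : ⊤ ≤ Submodule.span ℤ (Set.range (Subtype.val : R.simple f → L)) := by
    intro x _
    rw [Subtype.range_val]
    have hx : x ∈ AddSubgroup.closure (R.simple f) := by
      rw [R.closure_simple hf hfin]
      trivial
    exact (AddSubgroup.closure_le (Submodule.span ℤ (R.simple f)).toAddSubgroup).2
      Submodule.subset_span hx
  let b := Module.Basis.mk (R.linearIndependent_simple hf hfin) hspan
  let χ : L →+ A := (b.constr ℤ fun i => ψ i).toAddMonoidHom
  have hχ : ∀ α ∈ R.simple f, χ α = ψ α := by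
    intro α hα
    have h1 : b ⟨α, hα⟩ = α := by rw [Module.Basis.mk_apply]
    have h2 : (b.constr ℤ fun i => ψ i) (b ⟨α, hα⟩) = ψ α := b.constr_basis ℤ _ _
    rwa [h1] at h2
  have hpos : ∀ α ∈ R.positive f, χ α = ψ α := by
    refine R.positive_induction hfin fun α hα ih => ?_
    by_cases hs : α ∈ R.simple f
    · exact hχ α hs
    · have : ∃ β ∈ R.positive f, ∃ γ ∈ R.positive f, α = β + γ := by
        by_contra! hcon
        exact hs ⟨hα, hcon⟩
      obtain ⟨β, hβ, γ, hγ, rfl⟩ := this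
      rw [hψ β hβ.1 γ hγ.1 hα.1, map_add, ih β hβ ?_, ih γ hγ ?_]
      · rw [map_add]
        linarith [hβ.2]
      · rw [map_add]
        linarith [hγ.2]
  have hψ0 : ψ 0 = 0 := by
    have := hψ 0 R.zero_mem_roots 0 R.zero_mem_roots (by rw [add_zero]; exact R.zero_mem_roots)
    rwa [add_zero, left_eq_add] at this
  refine ⟨χ, fun α hα => ?_⟩
  by_cases h0 : α = 0
  · rw [h0, hψ0, map_zero]
  rcases R.positive_or_neg hf hα h0 with h | h
  · exact hpos α h
  · have h1 := hψ α hα (-α) (R.neg_mem hα) (by rw [add_neg_cancel]; exact R.zero_mem_roots)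
    rw [add_neg_cancel, hψ0, ← hpos _ h, map_neg] at h1
    exact (sub_eq_zero.1 (by rw [h1, sub_eq_add_neg])).symm

end Positive

end LatticeRootSystem

/-! ### Finiteness of coroots, and extension of characters in nullity at most one -/

namespace ExtendedAffineLieAlgebra

variable {E : Type*} [LieRing E] [LieAlgebra ℂ E] (T : ExtendedAffineLieAlgebra E)
variable {α β δ : T.CartanDual}

/-- The form is complex, so no positivity is at hand. With `b = (β, β) / (α, α)`, integrality of the
Cartan integer of `α` against `β - jα` gives `|b - j(k - j)| ≤ k - 2j` whenever `k > 2j`. The cases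
`j = 0` and `j = 3` give `3(k - 3) ≤ 2k - 6`, that is `k ≤ 3`; the bound `6` is what makes `j = 3`
admissible. -/
theorem cartanInteger_le_six (hα : α ∈ T.nonisotropicRoots) (hβ : β ∈ T.nonisotropicRoots) {k : ℤ}
    (hk : 2 * T.dualForm β α / T.dualForm α α = k) : k ≤ 6 := by
  by_contra! h7
  have hN := hα.2
  set N := T.dualForm α α with hNdef
  set b := T.dualForm β β / N with hb
  have hk' := hk
  rw [div_eq_iff hN] at hk'
  have key : ∀ j : ℤ, 0 ≤ j → j ≤ 3 → ‖b - j * (k - j)‖ ≤ k - 2 * j := by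
    intro j h0 h3
    have hroot := T.sub_zsmul_mem_roots hα hβ.1 hk h0 (by omega)
    have hγγ : T.dualForm (β - j • α) (β - j • α) = N * (b - j * (k - j)) := by
      rw [sub_eq_add_neg, ← neg_smul, T.dualForm_add_left, T.dualForm_add_right,
        T.dualForm_add_right, T.dualForm_zsmul_left, T.dualForm_zsmul_left, T.dualForm_zsmul_right,
        T.dualForm_zsmul_right, T.dualForm_comm α β, ← hNdef, hb, mul_sub, mul_div_cancel₀ _ hN]
      push_cast
      linear_combination (-(j : ℂ)) * hk'
    have hαγ : 2 * T.dualForm α (β - j • α) = N * (k - 2 * j) := by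
      rw [sub_eq_add_neg, ← neg_smul, T.dualForm_add_right, T.dualForm_zsmul_right,
        T.dualForm_comm α β, ← hNdef]
      push_cast
      linear_combination hk'
    have hne : ((k : ℂ) - 2 * j) ≠ 0 := by
      have : k - 2 * j ≠ 0 := by omega
      exact_mod_cast this
    have hiso : β - j • α ∈ T.nonisotropicRoots := by
      refine (T.mem_roots_cases hroot).resolve_right fun hi => ?_
      rw [T.dualForm_eq_zero_of_isotropic hα hi, mul_zero] at hαγ
      exact mul_ne_zero hN hne hαγ.symm
    obtain ⟨m, hm⟩ := T.exists_int_eq hiso hα.1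
    have hne' := hiso.2
    rw [hγγ] at hne' hm
    rw [hαγ, mul_div_mul_left _ _ hN, div_eq_iff (right_ne_zero_of_mul hne')] at hm
    have hm0 : m ≠ 0 := by
      rintro rfl
      rw [Int.cast_zero, zero_mul] at hm
      exact hne hm
    have hm1 : (1 : ℝ) ≤ ‖(m : ℂ)‖ := by
      rw [Complex.norm_intCast]
      exact_mod_cast Int.one_le_abs hm0
    have h4 : ‖(k : ℂ) - 2 * j‖ = (k : ℝ) - 2 * j := by
      have : (k : ℂ) - 2 * j = ((k - 2 * j : ℤ) : ℂ) := by push_cast; rfl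
      rw [this, Complex.norm_intCast, abs_of_pos]
      · push_cast
        rfl
      · exact_mod_cast (by omega : 0 < k - 2 * j)
    rw [← h4, hm, norm_mul]
    exact le_mul_of_one_le_left (norm_nonneg _) hm1
  have h0 := key 0 le_rfl (by norm_num)
  have h3 := key 3 (by norm_num) le_rfl
  have h5 : ‖(3 * (k - 3) : ℂ)‖ = 3 * ((k : ℝ) - 3) := by
    have : (3 * (k - 3) : ℂ) = ((3 * (k - 3) : ℤ) : ℂ) := by push_cast; rfl
    rw [this, Complex.norm_intCast, abs_of_pos]
    · push_cast
      rfl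
    · exact_mod_cast (by omega : 0 < 3 * (k - 3))
  have h6 := norm_sub_le b (b - 3 * (k - 3))
  rw [sub_sub_cancel, h5] at h6
  simp only [Int.cast_zero, zero_mul, sub_zero, mul_zero] at h0
  push_cast at h3
  have h7' : (7 : ℝ) ≤ k := by exact_mod_cast h7
  linarith

theorem abs_cartanInteger_le_six (hα : α ∈ T.nonisotropicRoots) (hβ : β ∈ T.nonisotropicRoots)
    {k : ℤ} (hk : 2 * T.dualForm β α / T.dualForm α α = k) : |k| ≤ 6 := by
  refine abs_le'.2 ⟨T.cartanInteger_le_six hα hβ hk, ?_⟩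
  refine T.cartanInteger_le_six (T.neg_mem_nonisotropicRoots hα) hβ ?_
  rw [T.two_mul_dualForm_neg_div, hk, Int.cast_neg]

theorem exists_int_eq_of_mem_rootLattice (hα : α ∈ T.nonisotropicRoots) (hβ : β ∈ T.rootLattice) :
    ∃ k : ℤ, 2 * T.dualForm β α / T.dualForm α α = k := by
  induction hβ using AddSubgroup.closure_induction with
  | mem x hx => exact T.exists_int_eq hα hx
  | zero => exact ⟨0, by rw [T.dualForm_zero_left, mul_zero, zero_div, Int.cast_zero]⟩
  | add x y _ _ hx hy =>
    obtain ⟨k, hk⟩ := hx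
    obtain ⟨l, hl⟩ := hy
    exact ⟨k + l, by rw [T.dualForm_add_left, mul_add, add_div, hk, hl, Int.cast_add]⟩
  | neg x _ hx =>
    obtain ⟨k, hk⟩ := hx
    exact ⟨-k, by rw [T.dualForm_neg_left, mul_neg, neg_div, hk, Int.cast_neg]⟩

open Classical in
/-- The coroot `β ↦ 2 (β, α) / (α, α)` of a non-isotropic root, on the root lattice. -/
def coroot (α : T.rootLattice) : T.rootLattice →+ ℤ :=
  if h : (α : T.CartanDual) ∈ T.nonisotropicRoots then
    { toFun := fun β => (T.exists_int_eq_of_mem_rootLattice h β.2).choose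
      map_zero' := by
        apply Int.cast_injective (α := ℂ)
        rw [← (T.exists_int_eq_of_mem_rootLattice h (0 : T.rootLattice).2).choose_spec,
          AddSubgroup.coe_zero, T.dualForm_zero_left, mul_zero, zero_div, Int.cast_zero]
      map_add' := fun x y => by
        apply Int.cast_injective (α := ℂ)
        rw [Int.cast_add, ← (T.exists_int_eq_of_mem_rootLattice h (x + y).2).choose_spec,
          ← (T.exists_int_eq_of_mem_rootLattice h x.2).choose_spec,
          ← (T.exists_int_eq_of_mem_rootLattice h y.2).choose_spec, AddSubgroup.coe_add,
          T.dualForm_add_left, mul_add, add_div] }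
  else 0

theorem coroot_spec {α : T.rootLattice} (h : (α : T.CartanDual) ∈ T.nonisotropicRoots)
    (β : T.rootLattice) :
    2 * T.dualForm β α / T.dualForm α α = T.coroot α β := by
  rw [coroot, dif_pos h]
  exact (T.exists_int_eq_of_mem_rootLattice h β.2).choose_spec

theorem exists_coroot_bound (x : T.rootLattice) :
    ∃ K : ℤ, ∀ α : T.rootLattice, (α : T.CartanDual) ∈ T.nonisotropicRoots →
      |T.coroot α x| ≤ K := by
  obtain ⟨x, hx⟩ := x
  induction hx using AddSubgroup.closure_induction with
  | mem x hx =>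
    refine ⟨6, fun α hα => ?_⟩
    have hspec := T.coroot_spec hα ⟨x, AddSubgroup.subset_closure hx⟩
    rcases T.mem_roots_cases hx with h | h
    · exact T.abs_cartanInteger_le_six hα h hspec
    · rw [T.dualForm_comm, T.dualForm_eq_zero_of_isotropic hα h, mul_zero, zero_div] at hspec
      rw [← Int.cast_injective (α := ℂ) (Int.cast_zero.trans hspec)]
      norm_num
  | zero => exact ⟨0, fun α _ => by
      change |T.coroot α 0| ≤ 0
      simp⟩
  | add x y hx hy h1 h2 =>
    obtain ⟨K, hK⟩ := h1
    obtain ⟨M, hM⟩ := h2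
    refine ⟨K + M, fun α hα => ?_⟩
    have := map_add (T.coroot α) ⟨x, hx⟩ ⟨y, hy⟩
    exact (congrArg abs this).trans_le ((abs_add_le _ _).trans (add_le_add (hK α hα) (hM α hα)))
  | neg x hx h1 =>
    obtain ⟨K, hK⟩ := h1
    refine ⟨K, fun α hα => ?_⟩
    have := map_neg (T.coroot α) ⟨x, hx⟩
    exact (congrArg abs this).trans_le ((abs_neg _).trans_le (hK α hα))

/-- A coroot is determined by its values on a finite generating set, and these are uniformly bounded
integers. -/
theorem finite_coroots :
    (T.coroot '' {α | (α : T.CartanDual) ∈ T.nonisotropicRoots}).Finite := by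
  have := T.rootLattice_finite
  obtain ⟨S, hS⟩ := Module.Finite.fg_top (R := ℤ) (M := T.rootLattice)
  choose K hK using T.exists_coroot_bound
  refine Set.Finite.of_finite_image (f := fun c (s : S) => c s) ?_ ?_
  · refine (Set.Finite.pi' fun s : S => Set.finite_Icc (-K s) (K s)).subset ?_
    rintro _ ⟨_, ⟨α, hα, rfl⟩, rfl⟩ s
    exact abs_le.1 (hK s α hα)
  · intro c _ c' _ h
    have : c.toIntLinearMap = c'.toIntLinearMap :=
      LinearMap.ext_on hS fun s hs => congrFun h ⟨s, hs⟩
    exact AddMonoidHom.ext fun x => LinearMap.congr_fun this x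

/-- The root system of an extended affine Lie algebra of reduced type, in its root lattice. -/
def latticeRootSystem (hred : T.IsReducedType) : LatticeRootSystem T.rootLattice where
  roots := {α | (α : T.CartanDual) ∈ T.roots}
  real := {α | (α : T.CartanDual) ∈ T.nonisotropicRoots}
  coroot := T.coroot
  real_subset := fun α hα => hα.1
  zero_mem_roots := T.zero_mem_roots
  neg_mem := fun h => T.neg_mem_roots h
  coroot_self := fun {α} hα => by
    apply Int.cast_injective (α := ℂ)
    have h2 := hα.2
    rw [← T.coroot_spec hα, mul_div_assoc, div_self h2, mul_one, Int.cast_ofNat]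
  coroot_eq_zero := fun {α δ} hα hδ hδ' => by
    apply Int.cast_injective (α := ℂ)
    have h := (T.mem_roots_cases hδ).resolve_left hδ'
    rw [← T.coroot_spec hα, T.dualForm_comm, T.dualForm_eq_zero_of_isotropic hα h, mul_zero,
      zero_div, Int.cast_zero]
  sub_zsmul_mem := fun {α β} hα hβ {j} h0 hj =>
    T.sub_zsmul_mem_roots hα hβ (T.coroot_spec hα β) h0 hj
  two_zsmul_notMem := fun {α} hα h2 => by
    refine hred _ hα _ h2 ?_
    have : ((((2 : ℤ) • α : T.rootLattice) : T.CartanDual) - (2 : ℝ) • (α : T.CartanDual)) = 0 := by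
      rw [AddSubgroup.coe_zsmul, sub_eq_zero]
      ext h
      simp
    rw [this]
    exact zero_mem _
  reflect_mem := fun {α β} hα hβ => T.reflect_mem_nonisotropicRoots hα hβ (T.coroot_spec hα β)
  coroot_reflect := fun {α β} hα hβ x => by
    apply Int.cast_injective (α := ℂ)
    have h1 := T.coroot_spec hα β
    have h2 := T.coroot_spec hα x
    have hmem : ((β - T.coroot α β • α : T.rootLattice) : T.CartanDual) ∈ T.nonisotropicRoots :=
      T.reflect_mem_nonisotropicRoots hα hβ h1
    have hα2 := hα.2
    rw [← T.coroot_spec hmem, ← T.coroot_spec hβ, AddSubgroup.coe_sub, AddSubgroup.coe_zsmul,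
      T.dualForm_reflect hα2 h1, AddSubgroup.coe_sub, AddSubgroup.coe_zsmul, sub_eq_add_neg,
      sub_eq_add_neg, ← neg_smul, ← neg_smul, T.dualForm_add_right, T.dualForm_add_left,
      T.dualForm_zsmul_left, T.dualForm_zsmul_right, Int.cast_neg, Int.cast_neg, ← h1, ← h2,
      T.dualForm_comm (α : T.CartanDual) β]
    congr 2
    ring
  -- Equal coroots give `(β, α) = (α, α)` and `(α, β) = (β, β)`, so `α - β` is isotropic.
  sub_notMem_real := fun {α β} hα hβ h hαβ => by
    have hα2 := hα.2
    have hβ2 := hβ.2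
    have h1 := T.coroot_spec hα β
    have h2 := T.coroot_spec hβ β
    rw [h, ← h2, mul_div_assoc, mul_div_assoc, div_self hβ2, mul_right_inj' two_ne_zero,
      div_eq_iff hα2, one_mul] at h1
    have h3 := T.coroot_spec hα α
    have h4 := T.coroot_spec hβ α
    rw [← h, ← h3, mul_div_assoc, mul_div_assoc, div_self hα2, mul_right_inj' two_ne_zero,
      div_eq_iff hβ2, one_mul] at h4
    refine hαβ.2 ?_
    rw [AddSubgroup.coe_sub, sub_eq_add_neg, T.dualForm_add_left, T.dualForm_add_right,
      T.dualForm_add_right, T.dualForm_neg_left, T.dualForm_neg_left, T.dualForm_neg_right,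
      T.dualForm_neg_right, h1, h4]
    ring
  exists_add_mem := fun {δ} hδ hδ' => by
    obtain ⟨α, hα, hαδ⟩ :=
      T.exists_add_mem_nonisotropicRoots ((T.mem_roots_cases hδ).resolve_left hδ')
    exact ⟨⟨α, AddSubgroup.subset_closure hα.1⟩, hα, hαδ⟩
  indecomposable := fun R₁ R₂ hR hdisj h1 h2 => by
    obtain ⟨_, ⟨α, hα, rfl⟩, _, ⟨β, hβ, rfl⟩, h⟩ := T.indecomposable (Subtype.val '' R₁)
      (Subtype.val '' R₂) (by
        rw [← Set.image_union, hR]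
        ext α
        constructor
        · rintro ⟨α, hα, rfl⟩
          exact hα
        · intro hα
          exact ⟨⟨α, AddSubgroup.subset_closure hα.1⟩, hα, rfl⟩)
      ((Set.disjoint_image_iff Subtype.val_injective).2 hdisj) (h1.image _) (h2.image _)
    refine ⟨α, hα, β, hβ, fun h0 => h ?_⟩
    have hα' : (α : T.CartanDual) ∈ T.nonisotropicRoots := hR.subset (Or.inl hα)
    have := T.coroot_spec hα' β
    rw [h0, Int.cast_zero, div_eq_zero_iff, or_iff_left hα'.2, mul_eq_zero,
      or_iff_right two_ne_zero] at this
    rw [T.dualForm_comm, this]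
  finite_coroots := T.finite_coroots
  closure_roots := by
    rw [eq_top_iff]
    rintro ⟨x, hx⟩ -
    induction hx using AddSubgroup.closure_induction with
    | mem x hx => exact AddSubgroup.subset_closure hx
    | zero => exact zero_mem _
    | add x y hx hy h1 h2 => exact add_mem h1 h2
    | neg x hx h1 => exact neg_mem h1

/-- A finitely generated free abelian group embeds into the real numbers. -/
theorem _root_.exists_injective_addMonoidHom_real (L : Type*) [AddCommGroup L] [Module.Free ℤ L]
    [Module.Finite ℤ L] : ∃ f : L →+ ℝ, Function.Injective f := by
  -- The reals have infinite rational rank; a basis of `L` is sent to rationally independent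
  -- numbers.
  have hrank : ((Module.finrank ℤ L : ℕ) : Cardinal) ≤ Module.rank ℚ ℝ := by
    rw [Real.rank_rat_real]
    exact (Cardinal.nat_lt_continuum _).le
  obtain ⟨s, hs, hli⟩ := le_rank_iff_exists_linearIndependent_finset.1 hrank
  have hli' : LinearIndependent ℤ (Subtype.val : s → ℝ) :=
    hli.restrict_scalars (fun a b h => by simpa using h)
  let b := (Module.finBasis ℤ L).reindex
    (Fintype.equivOfCardEq (by simp [hs]) : Fin (Module.finrank ℤ L) ≃ s)
  refine ⟨((Finsupp.linearCombination ℤ (Subtype.val : s → ℝ)).comp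
    b.repr.toLinearMap).toAddMonoidHom, ?_⟩
  have h : Function.Injective (Finsupp.linearCombination ℤ (Subtype.val : s → ℝ)) := hli'
  exact h.comp b.repr.injective

/-- `⟨R⁰⟩` is a subgroup of a lattice, hence free; of rank at most one, it is cyclic. -/
theorem exists_generator (h : T.nullity = 0 ∨ T.nullity = 1) :
    ∃ d : T.rootLattice, ∀ δ : T.rootLattice, (δ : T.CartanDual) ∈ T.isotropicRoots →
      ∃ k : ℤ, δ = k • d := by
  have := T.rootLattice_free
  have := T.rootLattice_finite
  have hle : AddSubgroup.closure T.isotropicRoots ≤ T.rootLattice :=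
    AddSubgroup.closure_mono fun δ hδ => hδ.1
  let ι : AddSubgroup.closure T.isotropicRoots →ₗ[ℤ] T.rootLattice :=
    (AddSubgroup.inclusion hle).toIntLinearMap
  have hι : Function.Injective ι := AddSubgroup.inclusion_injective hle
  have : Module.Finite ℤ (AddSubgroup.closure T.isotropicRoots) := Module.Finite.of_injective ι hι
  have : Module.IsTorsionFree ℤ (AddSubgroup.closure T.isotropicRoots) :=
    hι.moduleIsTorsionFree ι fun n x => map_smul ι n x
  have : Module.Free ℤ (AddSubgroup.closure T.isotropicRoots) :=
    Module.free_of_finite_type_torsion_free'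
  obtain ⟨d, hd⟩ : ∃ d : AddSubgroup.closure T.isotropicRoots, ∀ x, ∃ k : ℤ, x = k • d := by
    let b := Module.finBasis ℤ (AddSubgroup.closure T.isotropicRoots)
    rcases h with h | h
    · refine ⟨0, fun x => ⟨0, ?_⟩⟩
      have : IsEmpty (Fin (Module.finrank ℤ (AddSubgroup.closure T.isotropicRoots))) := by
        rw [show Module.finrank ℤ (AddSubgroup.closure T.isotropicRoots) = 0 from h]
        infer_instance
      rw [← b.sum_repr x]
      simp
    · let b' := b.reindex (finCongr h)
      refine ⟨b' 0, fun x => ⟨b'.repr x 0, ?_⟩⟩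
      conv_lhs => rw [← b'.sum_repr x]
      simp
  refine ⟨ι d, fun δ hδ => ?_⟩
  obtain ⟨k, hk⟩ := hd ⟨δ, AddSubgroup.subset_closure hδ⟩
  exact ⟨k, by rw [← map_zsmul, ← hk]; rfl⟩

theorem exists_rootLatticeCharacter_of_nullity (hred : T.IsReducedType)
    (h : T.nullity = 0 ∨ T.nullity = 1) (ψ : T.roots → ℂˣ) (hψ : T.IsCharacter ψ) :
    ∃ χ : T.RootLatticeCharacter, ∀ α : T.roots, χ.onRoot α = ψ α := by
  classical
  have := T.rootLattice_free
  have := T.rootLattice_finite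
  obtain ⟨f, hf⟩ := exists_injective_addMonoidHom_real T.rootLattice
  obtain ⟨d, hd⟩ := T.exists_generator h
  -- The value `0` off the roots is arbitrary: additivity is only required among roots.
  let φ : T.rootLattice → Additive ℂˣ := fun α =>
    if h : (α : T.CartanDual) ∈ T.roots then Additive.ofMul (ψ ⟨α, h⟩) else 0
  obtain ⟨χ, hχ⟩ := (T.latticeRootSystem hred).exists_extension (d := d) hf
    (fun δ hδ hδ' => hd δ ((T.mem_roots_cases hδ).resolve_left hδ')) φ
    (fun α hα β hβ hαβ => by
      have hα' : (α : T.CartanDual) ∈ T.roots := hα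
      have hβ' : (β : T.CartanDual) ∈ T.roots := hβ
      have hαβ' : ((α + β : T.rootLattice) : T.CartanDual) ∈ T.roots := hαβ
      simp only [φ]
      rw [dif_pos hα', dif_pos hβ', dif_pos hαβ', ← ofMul_mul]
      exact congrArg _ (hψ ⟨α, hα'⟩ ⟨β, hβ'⟩ ⟨_, hαβ'⟩ rfl))
  refine ⟨AddMonoidHom.toMultiplicativeLeft χ, fun α => ?_⟩
  have h1 := hχ ⟨α, AddSubgroup.subset_closure α.2⟩ α.2
  have h2 : φ ⟨α, AddSubgroup.subset_closure α.2⟩ = Additive.ofMul (ψ α) := dif_pos α.2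
  exact congrArg Additive.toMul (h1.trans h2)

end ExtendedAffineLieAlgebra

end

theorem mainTheorem5 {E : Type*} [LieRing E] [LieAlgebra ℂ E] (T : ExtendedAffineLieAlgebra E)
    (hred : T.IsReducedType) :
    (T.ind = 0 →
      ∀ Ψ : E ≃ₗ⁅ℂ⁆ E, T.IsCartanAutomorphism Ψ → IsFiniteOrderAut Ψ →
        ∃ χ : T.RootLatticeCharacter, IsOfFinOrder χ ∧
          ∀ α : T.roots, ∀ x ∈ T.rootSpace α, Ψ x = (χ.onRoot α : ℂ) • x) ∧
    ((T.nullity = 0 ∨ T.nullity = 1) →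
      ∀ ψ : T.roots → ℂˣ, T.IsCharacter ψ →
        ∃ χ : T.RootLatticeCharacter, ∀ α : T.roots, χ.onRoot α = ψ α) :=
  ⟨fun h _ hΨ hfin => T.exists_rootLatticeCharacter_of_ind_eq_zero h hΨ hfin,
    fun h ψ hψ => T.exists_rootLatticeCharacter_of_nullity hred h ψ hψ⟩
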